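/- Fix a propositional vocabulary $\Sigma$ and a set $\mathcal{A}$ of agents. **Prebiworlds and restriction.** By simultaneous transfinite recursion: a $0$-prebiworld is an interpretation over $\Sigma$ (a set of true atoms); a $(\mu+1)$-prebiworld $w$ is a triple $(w_0,(A^w)_{A\in\mathcal{A}},(\bar A^w)_{A\in\mathcal{A}})$ of an interpretation $w_0$ and, for each agent $A$, two sets $A^w,\bar A^w$ of $\mu$-prebiworlds; for a limit ordinal $\lambda$, a $\lambda$-prebiworld is a sequence $w=((w)_\alpha)_{\alpha<\lambda}$ of $\alpha$-prebiworlds $(w)_\alpha$ with $(w)_\alpha|_\gamma=(w)_\gamma$ for all $\gamma\le\alpha<\lambda$, and its objective interpretation $w_0$ is its element of index $0$. The restriction $w|_\alpha$ of a $\mu$-prebiworld $w$ to $\alpha\le\mu$ is $w_0$ if $\alpha=0$; it is $(w|_\gamma)_{\gamma<\alpha}$ if $\alpha$ is a limit; if $\alpha=\alpha'+1$, it is $(w)_\alpha$ when $\mu$ is a limit, and when $\mu$ is a successor it is the $\alpha$-prebiworld with the same objective interpretation and with the sets $\{w'|_{\alpha'} : w'\in A^w\}$ and $\{w'|_{\alpha'}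 : w'\in\bar A^w\}$. If $v=w|_\alpha$, then $w$ is called an extension of $v$. **Biworlds.** Every $0$-prebiworld is a $0$-biworld. For a limit $\lambda$, a $\lambda$-prebiworld is a $\lambda$-biworld iff all its elements $(w)_\alpha$ are $\alpha$-biworlds. For each $\mu$, the incompleted $\mu$-prebiworlds and the $(\mu+1)$-biworlds are the simultaneously defined smallest sets such that: a $\mu$-prebiworld is incompleted if it has two distinct extensions that are $(\mu+1)$-biworlds; a $(\mu+1)$-prebiworld $w$ is a $(\mu+1)$-biworld if for every agent $A$ the set $A^w\cup\bar A^w$ is the set of all $\mu$-biworlds and every element of $A^w\cap\bar A^w$ is incompleted. A prebiworld that is not incompleted is completed. A *world* is a completed $(\omega^2+1)$-biworld. **Formulas.** Formulas are built from the atoms in $\Sigma$ by $\neg$, $\wedge$, $K_A$ ("$A$ knows"), $M_A$ ("$A$ knows at most"), $E_G$ ("everyone in $G$ knows") and $C_G$ (common knowledge in $G$), for $A\in\mathcal{A}$ and $G\subseteq\mathcal{A}$. "$A$ only knows $\varphi$" is $O_A\varphi:=K_A\varphi\wedge M_A\varphi$. **Three-valued valuation.** The value $\varphi^w\in\{\mathbf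 t,\mathbf f,\mathbf u\}$ at a biworld $w$ is given as follows, where the greatest lower bounds are for the truth order $\mathbf f\le\mathbf u\le\mathbf t$ and the least upper bounds for the precision order $\mathbf u\le\mathbf t$, $\mathbf u\le\mathbf f$. An atom is $\mathbf t$ if it is true in $w_0$, and $\mathbf f$ otherwise; $\wedge$ is the greatest lower bound; $\neg$ exchanges $\mathbf t$ and $\mathbf f$ and fixes $\mathbf u$. At depth $0$, $K_A\varphi$ and $M_A\varphi$ have value $\mathbf u$. At successor depth, $(K_A\varphi)^w=\mathrm{glb}\{\varphi^{w'} : w'\in A^w\}$ and $(M_A\varphi)^w=\mathrm{glb}\{(\neg\varphi)^{w'} : w'\in\bar A^w\}$. At limit depth, the value of $K_A\varphi$ (of $M_A\varphi$) is the least upper bound of its values at the elements $(w)_\alpha$. Finally, $(E_G\varphi)^w=\mathrm{glb}\{(K_A\varphi)^w : A\in G\}$ and $(C_G\varphi)^w=\mathrm{glb}\{(E_G^k\varphi)^w : k\ge1\}$. **Canonical Kripke structure.** $\mathcal{K}^*$ is the Kripke structure whose worlds are all the worlds defined above, in which an atom holds at $w$ iff it is true in $w_0$, and in which $w R_A w'$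 iff $w'|_{\omega^2}\in A^w$. The two-valued valuation $\varphi^{\mathcal{K}^*,w}$ is the usual one: $K_A\varphi$ holds at $w$ iff $\varphi$ holds at every $w'$ with $wR_Aw'$; $M_A\varphi$ holds at $w$ iff every world $w'$ at which $\varphi$ holds satisfies $wR_Aw'$; $E_G\varphi$ holds at $w$ iff $K_A\varphi$ holds at $w$ for all $A\in G$; $C_G\varphi$ holds at $w$ iff $\varphi$ holds at every world reachable from $w$ in one or more steps along $\bigcup_{A\in G}R_A$. **Theorem.** Let $A$ be an agent. For every formula $\varphi$ there is a world $w$ such that $(O_A\varphi)^w=(O_A\varphi)^{\mathcal{K}^*,w}=\mathbf t$. Moreover, if $w_1$ and $w_2$ are two such worlds, then $A^{w_1}=A^{w_2}$ and $\bar A^{w_1}=\bar A^{w_2}$. -/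

import Mathlib

universe u v

/-! ## Three truth values -/

/-- The truth values true (`t`), false (`f`) and unknown (`u`). -/
inductive TV : Type
  | t | f | u

namespace TV

/-- The inverse of a truth value. -/
def inv : TV → TV
  | t => f
  | f => t
  | u => u

/-- The truth order `f ≤ u ≤ t`. -/
def leT : TV → TV → Prop
  | f, _ => True
  | u, f => False
  | u, _ => True
  | t, t => True
  | t, _ => False

/-- The precision order: `u ≤ f`, `u ≤ t`, while `t` and `f` are incomparable. -/
def leP : TV → TV → Prop
  | u, _ => True
  | t, t => True
  | f, f => True
  | _, _ => False

open Classical in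
/-- Greatest lower bound of a set of truth values in the truth order. -/
noncomputable def glbT (S : Set TV) : TV :=
  if f ∈ S then f else if u ∈ S then u else t

open Classical in
/-- Least upper bound of a set of truth values in the precision order; it exists exactly when
the set does not contain both `t` and `f`. -/
noncomputable def lubP (S : Set TV) : TV :=
  if t ∈ S then t else if f ∈ S then f else u

theorem leT_glbT_iff (S : Set TV) (a : TV) : leT a (glbT S) ↔ ∀ b ∈ S, leT a b := by
  unfold glbT
  split_ifs with h1 h2
  · refine ⟨fun h b _ => ?_, fun h => h f h1⟩
    cases a <;> cases b <;> simp_all [leT]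
  · refine ⟨fun h b hb => ?_, fun h => h u h2⟩
    cases a <;> cases b <;> simp_all [leT]
  · refine ⟨fun h b hb => ?_, fun h => ?_⟩
    · cases a <;> cases b <;> simp_all [leT]
    · cases a <;> simp [leT]

theorem lubP_leP_iff (S : Set TV) (hS : ¬ (t ∈ S ∧ f ∈ S)) (a : TV) :
    leP (lubP S) a ↔ ∀ b ∈ S, leP b a := by
  unfold lubP
  split_ifs with h1 h2
  · refine ⟨fun h b hb => ?_, fun h => h t h1⟩
    cases a <;> cases b <;> simp_all [leP]
  · refine ⟨fun h b hb => ?_, fun h => h f h2⟩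
    cases a <;> cases b <;> simp_all [leP]
  · refine ⟨fun h b hb => ?_, fun h => ?_⟩
    · cases a <;> cases b <;> simp_all [leP]
    · cases a <;> simp [leP]

end TV

/-! ## Prebiworlds, restriction and precision -/

/-- A triple consisting of an interpretation (the set of true atoms) and, for every agent `A`,
two sets `pos A` and `neg A` of elements of `T`. -/
@[ext]
structure EpistemicTriple (Atom : Type u) (Agent : Type v) (T : Type (max 1 u v)) :
    Type (max 1 u v) where
  obj : Set Atom
  pos : Agent → Set T
  neg : Agent → Set T

/-- Raw prebiworlds of depth `μ`: an interpretation for `μ = 0`; a triple of an interpretation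
and two agent-indexed families of sets of raw prebiworlds of depth `μ'` for `μ = μ' + 1`; and
a sequence `(w_α)_{α < μ}` with `w_α` of depth `α` for a limit ordinal `μ`. The requirement
that these sequences be increasing for the precision order is imposed by `IsPrebiworld`. -/
noncomputable def RawBiworld (Atom : Type u) (Agent : Type v) (μ : Ordinal.{0}) :
    Type (max 1 u v) :=
  Ordinal.limitRecOn (motive := fun _ => Type (max 1 u v)) μ
    (ULift.{max 1 v} (Set Atom))
    (fun _ T => EpistemicTriple Atom Agent T)
    (fun l _ T => ∀ α : Ordinal.{0}, ∀ h : α < l, T α h)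

namespace RawBiworld

variable {Atom : Type u} {Agent : Type v}

/-- Raw prebiworlds of depth `0` are interpretations. -/
noncomputable def zeroEquiv : RawBiworld Atom Agent 0 ≃ Set Atom :=
  (Equiv.cast (Ordinal.limitRecOn_zero _ _ _)).trans Equiv.ulift

/-- Raw prebiworlds of successor depth are triples. -/
noncomputable def succEquiv (μ : Ordinal.{0}) :
    RawBiworld Atom Agent (μ + 1) ≃ EpistemicTriple Atom Agent (RawBiworld Atom Agent μ) :=
  Equiv.cast (Ordinal.limitRecOn_add_one _ _ _ _)

/-- Raw prebiworlds of limit depth are sequences. -/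
noncomputable def limEquiv (l : Ordinal.{0}) (hl : Order.IsSuccLimit l) :
    RawBiworld Atom Agent l ≃ (∀ α : Ordinal.{0}, α < l → RawBiworld Atom Agent α) :=
  Equiv.cast (Ordinal.limitRecOn_limit _ _ _ _ hl)

/-- `A^w`: the `μ`-prebiworlds that `w` marks as possible for `A`. -/
noncomputable def pos {μ : Ordinal.{0}} (w : RawBiworld Atom Agent (μ + 1)) (A : Agent) :
    Set (RawBiworld Atom Agent μ) :=
  (succEquiv μ w).pos A

/-- `Ā^w`: the `μ`-prebiworlds that `w` marks as impossible for `A`. -/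
noncomputable def neg {μ : Ordinal.{0}} (w : RawBiworld Atom Agent (μ + 1)) (A : Agent) :
    Set (RawBiworld Atom Agent μ) :=
  (succEquiv μ w).neg A

/-- The element `(w)_α` of the sequence `w` of limit length `l`. -/
noncomputable def elem {l : Ordinal.{0}} (hl : Order.IsSuccLimit l) (w : RawBiworld Atom Agent l)
    (α : Ordinal.{0}) (hα : α < l) : RawBiworld Atom Agent α :=
  limEquiv l hl w α hα

/-- The objective interpretation of a prebiworld. -/
noncomputable def obj {μ : Ordinal.{0}} : RawBiworld Atom Agent μ → Set Atom :=
  Ordinal.limitRecOn (motive := fun μ => RawBiworld Atom Agent μ → Set Atom) μ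
    (fun w => zeroEquiv w)
    (fun μ' _ w => (succEquiv μ' w).obj)
    (fun _ hl _ w => zeroEquiv (elem hl w 0 (pos_iff_ne_zero.mpr hl.ne_bot)))

/-- Restriction from depth `α` to depth `β`, by recursion on `β`, where `step` tells how to
restrict to successor depths. -/
noncomputable def restrAux {α : Ordinal.{0}}
    (step : ∀ β' : Ordinal.{0}, β' + 1 ≤ α → RawBiworld Atom Agent α →
      RawBiworld Atom Agent (β' + 1)) (β : Ordinal.{0}) :
    β ≤ α → RawBiworld Atom Agent α → RawBiworld Atom Agent β :=
  Ordinal.limitRecOn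
    (motive := fun β => β ≤ α → RawBiworld Atom Agent α → RawBiworld Atom Agent β) β
    (fun _ w => zeroEquiv.symm w.obj)
    (fun β' _ h w => step β' h w)
    (fun l hl ih h w => (limEquiv l hl).symm fun γ hγ => ih γ hγ (hγ.le.trans h) w)

/-- The restriction `w|_β` of a prebiworld `w` of depth `α` to depth `β ≤ α`. -/
noncomputable def restr {α : Ordinal.{0}} :
    ∀ β : Ordinal.{0}, β ≤ α → RawBiworld Atom Agent α → RawBiworld Atom Agent β :=
  Ordinal.limitRecOn
    (motive := fun α => ∀ β : Ordinal.{0}, β ≤ α →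
      RawBiworld Atom Agent α → RawBiworld Atom Agent β) α
    (restrAux fun _ h _ => absurd h (not_le.mpr (by simp)))
    (fun α' ih => restrAux fun β' h w => (succEquiv β').symm
      { obj := w.obj
        pos := fun A => ih β' (by simpa using h) '' w.pos A
        neg := fun A => ih β' (by simpa using h) '' w.neg A })
    (fun _ hl _ => restrAux fun β' h w => elem hl w (β' + 1)
      (lt_of_le_of_ne h (by rintro rfl; exact Order.not_isSuccLimit_add_one _ hl)))

/-- `w` is a prebiworld: hereditarily, the sequences of limit length are increasing for the
precision order, in which `w_γ` is below `w_α` iff `w_α|_γ = w_γ`. -/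
def IsPrebiworld {μ : Ordinal.{0}} : RawBiworld Atom Agent μ → Prop :=
  Ordinal.limitRecOn (motive := fun μ => RawBiworld Atom Agent μ → Prop) μ
    (fun _ => True)
    (fun _ ih w => ∀ A : Agent, (∀ x ∈ w.pos A, ih x) ∧ (∀ x ∈ w.neg A, ih x))
    (fun l hl ih w => (∀ (α : Ordinal.{0}) (hα : α < l), ih α hα (elem hl w α hα)) ∧
      ∀ (γ α : Ordinal.{0}) (hγα : γ ≤ α) (hα : α < l),
        restr γ hγα (elem hl w α hα) = elem hl w γ (hγα.trans_lt hα))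

/-! ## Biworlds and incompletedness

At each level `μ`, given the set `W` of `μ`-biworlds, the incompleted `μ`-prebiworlds and the
`(μ+1)`-biworlds are defined simultaneously, as the smallest sets closed under their
defining clauses. -/

mutual

/-- `w` is an incompleted `μ`-prebiworld: it has two distinct extensions that are
`(μ+1)`-biworlds. Here `W` is the set of `μ`-biworlds. -/
inductive IncompletedOver {Atom : Type u} {Agent : Type v} {μ : Ordinal.{0}}
    (W : Set (RawBiworld Atom Agent μ)) : RawBiworld Atom Agent μ → Prop
  | intro (w : RawBiworld Atom Agent μ) (w₁ w₂ : RawBiworld Atom Agent (μ + 1))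
      (hw : IsPrebiworld w) (hne : w₁ ≠ w₂)
      (h₁ : SuccBiworldOver W w₁) (h₂ : SuccBiworldOver W w₂)
      (hr₁ : restr μ (le_add_of_nonneg_right zero_le_one) w₁ = w)
      (hr₂ : restr μ (le_add_of_nonneg_right zero_le_one) w₂ = w) :
      IncompletedOver W w

/-- `w` is a `(μ+1)`-biworld: for every agent `A`, the union of `A^w` and `Ā^w` is the set `W`
of all `μ`-biworlds, and every element of their intersection is incompleted. -/
inductive SuccBiworldOver {Atom : Type u} {Agent : Type v} {μ : Ordinal.{0}}
    (W : Set (RawBiworld Atom Agent μ)) : RawBiworld Atom Agent (μ + 1) → Prop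
  | intro (w : RawBiworld Atom Agent (μ + 1)) (hw : IsPrebiworld w)
      (hunion : ∀ A : Agent, w.pos A ∪ w.neg A = W)
      (hinter : ∀ (A : Agent) (x : RawBiworld Atom Agent μ),
        x ∈ w.pos A → x ∈ w.neg A → IncompletedOver W x) :
      SuccBiworldOver W w

end

/-- The set `W^μ` of `μ`-biworlds. -/
def biworlds (μ : Ordinal.{0}) : Set (RawBiworld Atom Agent μ) :=
  Ordinal.limitRecOn (motive := fun μ => Set (RawBiworld Atom Agent μ)) μ
    {w | IsPrebiworld w}
    (fun _ W => {w | SuccBiworldOver W w})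
    (fun l hl W => {w | IsPrebiworld w ∧
      ∀ (α : Ordinal.{0}) (hα : α < l), elem hl w α hα ∈ W α hα})

/-- A prebiworld is completed if it is not incompleted. -/
def Completed {μ : Ordinal.{0}} (w : RawBiworld Atom Agent μ) : Prop :=
  ¬ IncompletedOver (biworlds μ) w

end RawBiworld

/-! ## Syntax -/

/-- Formulas of the logic of common knowledge and only knowing. -/
inductive Formula (Atom : Type u) (Agent : Type v) : Type (max u v)
  | atom : Atom → Formula Atom Agent
  | neg : Formula Atom Agent → Formula Atom Agent
  | and : Formula Atom Agent → Formula Atom Agent → Formula Atom Agent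
  /-- `K_A φ`: agent `A` knows `φ`. -/
  | knows : Agent → Formula Atom Agent → Formula Atom Agent
  /-- `M_A φ`: agent `A` knows at most `φ`. -/
  | atMost : Agent → Formula Atom Agent → Formula Atom Agent
  /-- `E_G φ`: every agent in `G` knows `φ`. -/
  | everyone : Set Agent → Formula Atom Agent → Formula Atom Agent
  /-- `C_G φ`: `φ` is common knowledge within `G`. -/
  | common : Set Agent → Formula Atom Agent → Formula Atom Agent

namespace Formula

variable {Atom : Type u} {Agent : Type v}

/-- `O_A φ`, "`A` only knows `φ`", is `K_A φ ∧ M_A φ`. -/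
def onlyKnows (A : Agent) (φ : Formula Atom Agent) : Formula Atom Agent :=
  (knows A φ).and (atMost A φ)

/-! ## The three-valued valuation -/

/-- The value of `K_A φ` at a biworld, where `g` is the valuation of `φ`. -/
noncomputable def knowsVal (A : Agent) (g : ∀ μ : Ordinal.{0}, RawBiworld Atom Agent μ → TV)
    (μ : Ordinal.{0}) : RawBiworld Atom Agent μ → TV :=
  Ordinal.limitRecOn (motive := fun μ => RawBiworld Atom Agent μ → TV) μ
    (fun _ => TV.u)
    (fun μ' _ w => TV.glbT {x | ∃ w' ∈ w.pos A, x = g μ' w'})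
    (fun l hl ih w => TV.lubP {x | ∃ (α : Ordinal.{0}) (hα : α < l), x = ih α hα (w.elem hl α hα)})

/-- The value of `M_A φ` at a biworld, where `g` is the valuation of `φ`. -/
noncomputable def atMostVal (A : Agent) (g : ∀ μ : Ordinal.{0}, RawBiworld Atom Agent μ → TV)
    (μ : Ordinal.{0}) : RawBiworld Atom Agent μ → TV :=
  Ordinal.limitRecOn (motive := fun μ => RawBiworld Atom Agent μ → TV) μ
    (fun _ => TV.u)
    (fun μ' _ w => TV.glbT {x | ∃ w' ∈ w.neg A, x = (g μ' w').inv})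
    (fun l hl ih w => TV.lubP {x | ∃ (α : Ordinal.{0}) (hα : α < l), x = ih α hα (w.elem hl α hα)})

/-- The value of `E_G φ` at a biworld, where `g` is the valuation of `φ`. -/
noncomputable def everyoneVal (G : Set Agent)
    (g : ∀ μ : Ordinal.{0}, RawBiworld Atom Agent μ → TV)
    (μ : Ordinal.{0}) (w : RawBiworld Atom Agent μ) : TV :=
  TV.glbT {x | ∃ A ∈ G, x = knowsVal A g μ w}

open Classical in
/-- The value `φ^w` of a formula at a biworld. For `C_G φ`, the `k`-th iterate of
`everyoneVal G` at the valuation of `φ` is the valuation of `E_G^k φ`. -/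
noncomputable def val : Formula Atom Agent → ∀ μ : Ordinal.{0}, RawBiworld Atom Agent μ → TV
  | atom p => fun _ w => if p ∈ w.obj then TV.t else TV.f
  | neg φ => fun μ w => (val φ μ w).inv
  | and φ ψ => fun μ w => TV.glbT {val φ μ w, val ψ μ w}
  | knows A φ => knowsVal A (val φ)
  | atMost A φ => atMostVal A (val φ)
  | everyone G φ => everyoneVal G (val φ)
  | common G φ => fun μ w => TV.glbT {x | ∃ k : ℕ, 1 ≤ k ∧ x = (everyoneVal G)^[k] (val φ) μ w}

/-- `(C_G φ)^w` is the greatest lower bound of the values `(E_G^k φ)^w` for `k ≥ 1`. -/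
theorem val_common (G : Set Agent) (φ : Formula Atom Agent) (μ : Ordinal.{0})
    (w : RawBiworld Atom Agent μ) :
    (common G φ).val μ w = TV.glbT {x | ∃ k : ℕ, 1 ≤ k ∧ x = ((everyone G)^[k] φ).val μ w} := by
  have h : ∀ k : ℕ, ((everyone G)^[k] φ).val = (everyoneVal G)^[k] φ.val := by
    intro k
    induction k with
    | zero => rfl
    | succ k ih => rw [Function.iterate_succ_apply', Function.iterate_succ_apply', ← ih]; rfl
  simp only [h]
  rfl

end Formula

/-! ## Kripke semantics -/

/-- A Kripke structure with an accessibility relation for every agent; `interp` gives the atoms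
that are true at a world. -/
structure KripkeStructure (Atom : Type u) (Agent : Type v) where
  World : Type (max 1 u v)
  interp : World → Set Atom
  rel : Agent → World → World → Prop

namespace KripkeStructure

variable {Atom : Type u} {Agent : Type v}

/-- Satisfaction of a formula at a world of a Kripke structure. -/
def Sat (K : KripkeStructure Atom Agent) : Formula Atom Agent → K.World → Prop
  | .atom p, w => p ∈ K.interp w
  | .neg φ, w => ¬ Sat K φ w
  | .and φ ψ, w => Sat K φ w ∧ Sat K ψ w
  | .knows A φ, w => ∀ w', K.rel A w w' → Sat K φ w'
  | .atMost A φ, w => ∀ w', Sat K φ w' → K.rel A w w'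
  | .everyone G φ, w => ∀ A ∈ G, ∀ w', K.rel A w w' → Sat K φ w'
  | .common G φ, w => ∀ w', Relation.TransGen (fun x y => ∃ A ∈ G, K.rel A x y) w w' → Sat K φ w'

open Classical in
/-- The two-valued valuation `φ^{K,w}`. -/
noncomputable def val (K : KripkeStructure Atom Agent) (φ : Formula Atom Agent) (w : K.World) :
    TV :=
  if K.Sat φ w then TV.t else TV.f

end KripkeStructure

/-! ## Worlds and the canonical Kripke structure -/

/-- The ordinal `ω²`. -/
noncomputable def omegaSq : Ordinal.{0} := Ordinal.omega0 ^ (2 : Ordinal.{0})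

/-- A world is a completed `(ω²+1)`-biworld. -/
def CompletedWorld (Atom : Type u) (Agent : Type v) : Type (max 1 u v) :=
  {w : RawBiworld Atom Agent (omegaSq + 1) // w ∈ RawBiworld.biworlds (omegaSq + 1) ∧ w.Completed}

/-- The canonical Kripke structure `K*`, whose worlds are all completed `(ω²+1)`-biworlds, with
`w R_A w'` iff `w'|_{ω²} ∈ A^w`. -/
noncomputable def canonicalKripke (Atom : Type u) (Agent : Type v) :
    KripkeStructure Atom Agent where
  World := CompletedWorld Atom Agent
  interp := fun w => w.1.obj
  rel := fun A w w' =>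
    w'.1.restr omegaSq (le_add_of_nonneg_right zero_le_one) ∈ w.1.pos A

-- At prebiworlds of depth ω² every formula has value t or f. Passing to an extension never changes
-- such a value (`val_precisionMono`), and a formula is decided from some depth ω·n on
-- (`exists_decidedFrom`). So φ splits the ω²-biworlds into those where it is true and those where
-- it is false. With these two sets as possible and impossible sets one obtains an (ω²+1)-biworld
-- with no undecided element; it is completed, and O_A φ is true there. Conversely, A^w and Ā^w
-- cover the ω²-biworlds, so truth of O_A φ forces them to be these two sets, which is uniqueness.
--
-- It remains to compare with K* (`sat_iff_val_eq_t`). The three-valued clauses quantify over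
-- ω²-biworlds and the Kripke clauses over worlds. Hence every ω²-biworld must underlie a world,
-- and, for M_A, a world must be undecided nowhere. Both facts rest on the behaviour of biworlds at
-- countable depth (`coherent_of_countable`): restrictions of biworlds are biworlds, biworlds extend
-- to greater depths, and restrictions of incompleted biworlds are incompleted.
--
-- The hard step is to extend a biworld w of limit depth l without leaving anything undecided. The
-- l-biworlds form an ultrametric space, whose balls are given by equality of restrictions. It is
-- covered by the sets P and N of biworlds that w allows as possible and as impossible, and
-- incompletedness says that no point of P ∩ N is isolated. The extension wanted is a partition into
-- a dense subset of P and a dense subset of N (`exists_dense_partition`); it comes from a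
-- two-colouring in which every ball with at least two points has both colours. Countability of l
-- gives a cofinal ω-sequence of depths, so balls are indexed by ℕ.

namespace RawBiworld

variable {Atom : Type u} {Agent : Type v}

-- Restriction of prebiworlds.

theorem obj_zero (w : RawBiworld Atom Agent 0) : w.obj = zeroEquiv w := by
  unfold obj; rw [Ordinal.limitRecOn_zero]

theorem obj_succ {μ : Ordinal.{0}} (w : RawBiworld Atom Agent (μ + 1)) :
    w.obj = (succEquiv μ w).obj := by
  unfold obj; rw [Ordinal.limitRecOn_add_one]

theorem obj_limit {l : Ordinal.{0}} (hl : Order.IsSuccLimit l) (w : RawBiworld Atom Agent l) :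
    w.obj = (elem hl w 0 (pos_iff_ne_zero.mpr hl.ne_bot)).obj := by
  rw [obj_zero]
  unfold obj; rw [Ordinal.limitRecOn_limit _ _ _ _ hl]

/-- The raw prebiworld of successor depth with the given components. -/
noncomputable def mk {μ : Ordinal.{0}} (a : Set Atom)
    (p n : Agent → Set (RawBiworld Atom Agent μ)) : RawBiworld Atom Agent (μ + 1) :=
  (succEquiv μ).symm ⟨a, p, n⟩

@[simp] theorem obj_mk {μ : Ordinal.{0}} (a : Set Atom)
    (p n : Agent → Set (RawBiworld Atom Agent μ)) : (mk a p n).obj = a := by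
  simp [obj_succ, mk]

@[simp] theorem pos_mk {μ : Ordinal.{0}} (a : Set Atom)
    (p n : Agent → Set (RawBiworld Atom Agent μ)) : (mk a p n).pos = p := by
  funext A; simp [pos, mk]

@[simp] theorem neg_mk {μ : Ordinal.{0}} (a : Set Atom)
    (p n : Agent → Set (RawBiworld Atom Agent μ)) : (mk a p n).neg = n := by
  funext A; simp [neg, mk]

theorem zero_ext {w w' : RawBiworld Atom Agent 0} (h : w.obj = w'.obj) : w = w' := by
  simpa [obj_zero] using h

theorem succ_ext {μ : Ordinal.{0}} {w w' : RawBiworld Atom Agent (μ + 1)} (h : w.obj = w'.obj)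
    (hp : ∀ A, w.pos A = w'.pos A) (hn : ∀ A, w.neg A = w'.neg A) : w = w' := by
  apply (succEquiv μ).injective
  rw [obj_succ, obj_succ] at h
  exact EpistemicTriple.ext h (funext hp) (funext hn)

theorem limit_ext {l : Ordinal.{0}} (hl : Order.IsSuccLimit l) {w w' : RawBiworld Atom Agent l}
    (h : ∀ γ hγ, elem hl w γ hγ = elem hl w' γ hγ) : w = w' :=
  (limEquiv l hl).injective (funext fun γ => funext fun hγ => h γ hγ)

theorem restrAux_zero {α : Ordinal.{0}}
    (step : ∀ β' : Ordinal.{0}, β' + 1 ≤ α → RawBiworld Atom Agent α →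
      RawBiworld Atom Agent (β' + 1)) (h : 0 ≤ α) (w : RawBiworld Atom Agent α) :
    restrAux step 0 h w = zeroEquiv.symm w.obj := by
  unfold restrAux; rw [Ordinal.limitRecOn_zero]

theorem restrAux_succ {α : Ordinal.{0}}
    (step : ∀ β' : Ordinal.{0}, β' + 1 ≤ α → RawBiworld Atom Agent α →
      RawBiworld Atom Agent (β' + 1)) (β : Ordinal.{0}) (h : β + 1 ≤ α)
    (w : RawBiworld Atom Agent α) :
    restrAux step (β + 1) h w = step β h w := by
  unfold restrAux; rw [Ordinal.limitRecOn_add_one]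

theorem restrAux_limit {α : Ordinal.{0}}
    (step : ∀ β' : Ordinal.{0}, β' + 1 ≤ α → RawBiworld Atom Agent α →
      RawBiworld Atom Agent (β' + 1)) {l : Ordinal.{0}} (hl : Order.IsSuccLimit l) (h : l ≤ α)
    (w : RawBiworld Atom Agent α) :
    restrAux step l h w =
      (limEquiv l hl).symm fun γ hγ => restrAux step γ (hγ.le.trans h) w := by
  unfold restrAux; rw [Ordinal.limitRecOn_limit _ _ _ _ hl]

/-- The clauses for target depth zero or limit do not depend on `step`, so this form gives them for
every source depth at once. -/
theorem exists_restr_eq (α : Ordinal.{0}) :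
    ∃ step, @restr Atom Agent α = restrAux step := by
  induction α using Ordinal.limitRecOn with
  | zero => exact ⟨_, by unfold restr; rw [Ordinal.limitRecOn_zero]⟩
  | add_one α _ => exact ⟨_, by unfold restr; rw [Ordinal.limitRecOn_add_one]⟩
  | limit l hl _ => exact ⟨_, by unfold restr; rw [Ordinal.limitRecOn_limit _ _ _ _ hl]⟩

theorem restr_zero {α : Ordinal.{0}} (h : 0 ≤ α) (w : RawBiworld Atom Agent α) :
    restr 0 h w = zeroEquiv.symm w.obj := by
  obtain ⟨s, hs⟩ := exists_restr_eq (Atom := Atom) (Agent := Agent) α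
  rw [hs, restrAux_zero]

theorem elem_restr {α l : Ordinal.{0}} (hl : Order.IsSuccLimit l) (h : l ≤ α)
    (w : RawBiworld Atom Agent α) (γ : Ordinal.{0}) (hγ : γ < l) :
    elem hl (restr l h w) γ hγ = restr γ (hγ.le.trans h) w := by
  obtain ⟨s, hs⟩ := exists_restr_eq (Atom := Atom) (Agent := Agent) α
  rw [hs, restrAux_limit s hl]
  simp [elem]

theorem restr_succ_succ {α β : Ordinal.{0}} (h : β + 1 ≤ α + 1)
    (w : RawBiworld Atom Agent (α + 1)) :
    restr (β + 1) h w = mk w.obj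
      (fun A => restr β (by simpa using h) '' w.pos A)
      (fun A => restr β (by simpa using h) '' w.neg A) := by
  conv_lhs => unfold restr
  rw [Ordinal.limitRecOn_add_one, restrAux_succ]
  rfl

theorem restr_succ_limit {β l : Ordinal.{0}} (hl : Order.IsSuccLimit l) (h : β + 1 ≤ l)
    (w : RawBiworld Atom Agent l) :
    restr (β + 1) h w = elem hl w (β + 1)
      (lt_of_le_of_ne h (by rintro rfl; exact Order.not_isSuccLimit_add_one _ hl)) := by
  conv_lhs => unfold restr
  rw [Ordinal.limitRecOn_limit _ _ _ _ hl, restrAux_succ]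

theorem isPrebiworld_zero (w : RawBiworld Atom Agent 0) : IsPrebiworld w := by
  unfold IsPrebiworld; rw [Ordinal.limitRecOn_zero]; trivial

theorem isPrebiworld_succ {μ : Ordinal.{0}} (w : RawBiworld Atom Agent (μ + 1)) :
    IsPrebiworld w ↔ ∀ A : Agent, (∀ x ∈ w.pos A, IsPrebiworld x) ∧
      (∀ x ∈ w.neg A, IsPrebiworld x) := by
  conv_lhs => unfold IsPrebiworld
  rw [Ordinal.limitRecOn_add_one]; rfl

theorem isPrebiworld_limit {l : Ordinal.{0}} (hl : Order.IsSuccLimit l)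
    (w : RawBiworld Atom Agent l) :
    IsPrebiworld w ↔ (∀ (α : Ordinal.{0}) (hα : α < l), IsPrebiworld (elem hl w α hα)) ∧
      ∀ (γ α : Ordinal.{0}) (hγα : γ ≤ α) (hα : α < l),
        restr γ hγα (elem hl w α hα) = elem hl w γ (hγα.trans_lt hα) := by
  conv_lhs => unfold IsPrebiworld
  rw [Ordinal.limitRecOn_limit _ _ _ _ hl]; rfl

theorem obj_restr_zero {α : Ordinal.{0}} (h : 0 ≤ α) (w : RawBiworld Atom Agent α) :
    (restr 0 h w).obj = w.obj := by
  rw [restr_zero, obj_zero]; simp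

/-- At limit depth, restriction to a smaller depth is evaluation of the sequence. -/
theorem restr_eq_elem {l : Ordinal.{0}} (hl : Order.IsSuccLimit l) {w : RawBiworld Atom Agent l}
    (hw : IsPrebiworld w) (γ : Ordinal.{0}) (hγ : γ < l) :
    restr γ hγ.le w = elem hl w γ hγ := by
  rw [isPrebiworld_limit hl] at hw
  induction γ using Ordinal.limitRecOn with
  | zero => exact zero_ext (by rw [obj_restr_zero, ← obj_limit])
  | add_one γ _ => exact restr_succ_limit hl _ w
  | limit γ hγl ih =>
    refine limit_ext hγl fun δ hδ => ?_
    rw [elem_restr, ih δ hδ (hδ.trans hγ), ← hw.2 γ γ le_rfl hγ, elem_restr, hw.2 δ γ hδ.le hγ]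

theorem obj_restr {α β : Ordinal.{0}} (h : β ≤ α) {w : RawBiworld Atom Agent α}
    (hw : IsPrebiworld w) : (restr β h w).obj = w.obj := by
  induction β using Ordinal.limitRecOn with
  | zero => exact obj_restr_zero h w
  | add_one β _ =>
    induction α using Ordinal.limitRecOn with
    | zero => simp at h
    | add_one α _ => rw [restr_succ_succ, obj_mk]
    | limit l hl _ =>
      rw [restr_succ_limit hl, ← obj_restr_zero (zero_le (a := β + 1)),
        ((isPrebiworld_limit hl w).1 hw).2, ← obj_limit]
  | limit l hl ih => rw [obj_limit hl, elem_restr, obj_restr_zero]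

theorem restr_self {α : Ordinal.{0}} (h : α ≤ α) {w : RawBiworld Atom Agent α}
    (hw : IsPrebiworld w) : restr α h w = w := by
  induction α using Ordinal.limitRecOn with
  | zero => exact zero_ext (obj_restr_zero _ _)
  | add_one α ih =>
    rw [isPrebiworld_succ] at hw
    rw [restr_succ_succ]
    refine succ_ext (by simp) (fun A => ?_) (fun A => ?_)
    · rw [pos_mk]
      exact (Set.image_congr fun x hx => ih _ ((hw A).1 x hx)).trans (Set.image_id _)
    · rw [neg_mk]
      exact (Set.image_congr fun x hx => ih _ ((hw A).2 x hx)).trans (Set.image_id _)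
  | limit l hl _ =>
    exact limit_ext hl fun γ hγ => by rw [elem_restr, restr_eq_elem hl hw]

/-- Raw sequences need not be coherent, so `IsPrebiworld` is essential at limit `α`. At successor
`α` the claim passes to the elements. -/
theorem restr_restr {α β γ : Ordinal.{0}} (hγ : γ ≤ β) (hβ : β ≤ α)
    {w : RawBiworld Atom Agent α} (hw : IsPrebiworld w) :
    restr γ hγ (restr β hβ w) = restr γ (hγ.trans hβ) w := by
  induction α using Ordinal.limitRecOn generalizing β γ with
  | zero =>
    obtain rfl : β = 0 := by simpa using hβ
    rw [restr_self hβ hw]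
  | add_one α ihα =>
    induction γ using Ordinal.limitRecOn with
    | zero => exact zero_ext (by rw [obj_restr_zero, obj_restr_zero, obj_restr hβ hw])
    | add_one γ _ =>
      induction β using Ordinal.limitRecOn with
      | zero => simp at hγ
      | add_one β _ =>
        rw [isPrebiworld_succ] at hw
        rw [restr_succ_succ, restr_succ_succ, restr_succ_succ]
        simp only [obj_mk, pos_mk, neg_mk, Set.image_image]
        congr 1
        · funext A
          exact Set.image_congr fun x hx => ihα _ _ ((hw A).1 x hx)
        · funext A
          exact Set.image_congr fun x hx => ihα _ _ ((hw A).2 x hx)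
      | limit β hl _ => rw [restr_succ_limit hl, elem_restr]
    | limit γ hl ih =>
      exact limit_ext hl fun δ hδ => by rw [elem_restr, elem_restr, ih δ hδ]
  | limit l hl ihα =>
    rcases hβ.eq_or_lt with rfl | hβl
    · rw [restr_self hβ hw]
    · rw [restr_eq_elem hl hw β hβl, restr_eq_elem hl hw γ (hγ.trans_lt hβl),
        ((isPrebiworld_limit hl w).1 hw).2]

theorem IsPrebiworld.restr {α β : Ordinal.{0}} (h : β ≤ α) {w : RawBiworld Atom Agent α}
    (hw : IsPrebiworld w) : IsPrebiworld (restr β h w) := by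
  induction α using Ordinal.limitRecOn generalizing β with
  | zero =>
    obtain rfl : β = 0 := by simpa using h
    exact isPrebiworld_zero _
  | add_one α ihα =>
    induction β using Ordinal.limitRecOn with
    | zero => exact isPrebiworld_zero _
    | add_one β _ =>
      rw [isPrebiworld_succ] at hw
      rw [restr_succ_succ, isPrebiworld_succ]
      simp only [pos_mk, neg_mk]
      refine fun A => ⟨?_, ?_⟩
      · rintro _ ⟨x, hx, rfl⟩; exact ihα _ ((hw A).1 x hx)
      · rintro _ ⟨x, hx, rfl⟩; exact ihα _ ((hw A).2 x hx)
    | limit l hl ih =>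
      rw [isPrebiworld_limit hl]
      refine ⟨fun δ hδ => ?_, fun γ δ hγ hδ => ?_⟩
      · rw [elem_restr]; exact ih δ hδ _
      · rw [elem_restr, elem_restr, restr_restr _ _ hw]
  | limit l hl _ =>
    rcases h.eq_or_lt with rfl | hl'
    · rwa [restr_self h hw]
    · rw [restr_eq_elem hl hw β hl']
      exact ((isPrebiworld_limit hl w).1 hw).1 β hl'

theorem pos_restr_succ {α β : Ordinal.{0}} (h : β + 1 ≤ α + 1) (h' : β ≤ α)
    (w : RawBiworld Atom Agent (α + 1)) (A : Agent) :
    (restr (β + 1) h w).pos A = restr β h' '' w.pos A := by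
  rw [restr_succ_succ, pos_mk]

theorem neg_restr_succ {α β : Ordinal.{0}} (h : β + 1 ≤ α + 1) (h' : β ≤ α)
    (w : RawBiworld Atom Agent (α + 1)) (A : Agent) :
    (restr (β + 1) h w).neg A = restr β h' '' w.neg A := by
  rw [restr_succ_succ, neg_mk]

theorem le_succ (μ : Ordinal.{0}) : μ ≤ μ + 1 := le_add_of_nonneg_right zero_le_one

theorem add_one_le_add_one {α β : Ordinal.{0}} (h : β ≤ α) : β + 1 ≤ α + 1 := by simpa using h

/-- A criterion for a prebiworld of depth `μ + 1` to extend one of depth `μ`. -/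
theorem restr_eq_of_image_eq {μ : Ordinal.{0}} {y : RawBiworld Atom Agent (μ + 1)}
    {w : RawBiworld Atom Agent μ} (hw : IsPrebiworld w) (hobj : y.obj = w.obj)
    (hpos : ∀ (α : Ordinal.{0}) (h : α + 1 ≤ μ) (A : Agent),
      restr α ((le_succ α).trans h) '' y.pos A = (restr (α + 1) h w).pos A)
    (hneg : ∀ (α : Ordinal.{0}) (h : α + 1 ≤ μ) (A : Agent),
      restr α ((le_succ α).trans h) '' y.neg A = (restr (α + 1) h w).neg A) :
    restr μ (le_succ μ) y = w := by
  suffices H : ∀ γ (h : γ ≤ μ), restr γ (h.trans (le_succ μ)) y = restr γ h w by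
    rw [H μ le_rfl, restr_self le_rfl hw]
  intro γ h
  induction γ using Ordinal.limitRecOn with
  | zero => exact zero_ext (by rw [obj_restr_zero, obj_restr_zero, hobj])
  | add_one γ _ =>
    refine succ_ext ?_ (fun A => ?_) (fun A => ?_)
    · rw [obj_restr _ hw, restr_succ_succ, obj_mk, hobj]
    · rw [pos_restr_succ _ ((le_succ γ).trans h), hpos]
    · rw [neg_restr_succ _ ((le_succ γ).trans h), hneg]
  | limit l hl ih => exact limit_ext hl fun δ hδ => by rw [elem_restr, elem_restr, ih δ hδ]

-- Biworlds and incompletedness as fixed points.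

theorem mem_biworlds_zero (w : RawBiworld Atom Agent 0) : w ∈ biworlds 0 := by
  unfold biworlds; rw [Ordinal.limitRecOn_zero]; exact isPrebiworld_zero w

theorem mem_biworlds_succ' {μ : Ordinal.{0}} (w : RawBiworld Atom Agent (μ + 1)) :
    w ∈ biworlds (μ + 1) ↔ SuccBiworldOver (biworlds μ) w := by
  conv_lhs => unfold biworlds
  rw [Ordinal.limitRecOn_add_one]; rfl

theorem mem_biworlds_limit {l : Ordinal.{0}} (hl : Order.IsSuccLimit l)
    (w : RawBiworld Atom Agent l) :
    w ∈ biworlds l ↔ IsPrebiworld w ∧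
      ∀ (α : Ordinal.{0}) (hα : α < l), elem hl w α hα ∈ biworlds α := by
  conv_lhs => unfold biworlds
  rw [Ordinal.limitRecOn_limit _ _ _ _ hl]; rfl

theorem isPrebiworld_of_mem {μ : Ordinal.{0}} {w : RawBiworld Atom Agent μ}
    (h : w ∈ biworlds μ) : IsPrebiworld w := by
  induction μ using Ordinal.limitRecOn with
  | zero => exact isPrebiworld_zero w
  | add_one μ _ =>
    rw [mem_biworlds_succ'] at h
    cases h; assumption
  | limit l hl _ => exact ((mem_biworlds_limit hl w).1 h).1

/-- `w` is incompleted, relative to the set of all biworlds of its depth. -/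
def Incompleted {μ : Ordinal.{0}} (w : RawBiworld Atom Agent μ) : Prop :=
  IncompletedOver (biworlds μ) w

theorem incompleted_iff {μ : Ordinal.{0}} (w : RawBiworld Atom Agent μ) :
    Incompleted w ↔ ∃ w₁ ∈ biworlds (μ + 1), ∃ w₂ ∈ biworlds (μ + 1), w₁ ≠ w₂ ∧
      restr μ (le_succ μ) w₁ = w ∧ restr μ (le_succ μ) w₂ = w := by
  constructor
  · intro h
    cases h with
    | intro w w₁ w₂ hw hne h₁ h₂ hr₁ hr₂ =>
      exact ⟨w₁, (mem_biworlds_succ' _).2 h₁, w₂, (mem_biworlds_succ' _).2 h₂, hne, hr₁, hr₂⟩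
  · rintro ⟨w₁, h₁, w₂, h₂, hne, hr₁, hr₂⟩
    exact .intro w w₁ w₂ (hr₁ ▸ (isPrebiworld_of_mem h₁).restr _) hne
      ((mem_biworlds_succ' _).1 h₁) ((mem_biworlds_succ' _).1 h₂) hr₁ hr₂

/-- Being a prebiworld is automatic, since all elements of `w` are biworlds. With `incompleted_iff`
this replaces the mutual induction: only the fixed-point equations are used later, never leastness.
-/
theorem mem_biworlds_succ {μ : Ordinal.{0}} (w : RawBiworld Atom Agent (μ + 1)) :
    w ∈ biworlds (μ + 1) ↔ (∀ A, w.pos A ∪ w.neg A = biworlds μ) ∧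
      ∀ A, ∀ x ∈ w.pos A, x ∈ w.neg A → Incompleted x := by
  rw [mem_biworlds_succ']
  constructor
  · intro h
    cases h with
    | intro w hw hu hi => exact ⟨hu, hi⟩
  · rintro ⟨hu, hi⟩
    refine .intro w ((isPrebiworld_succ w).2 fun A => ⟨fun x hx => ?_, fun x hx => ?_⟩) hu hi
    · exact isPrebiworld_of_mem (hu A ▸ Or.inl hx : x ∈ biworlds μ)
    · exact isPrebiworld_of_mem (hu A ▸ Or.inr hx : x ∈ biworlds μ)

theorem pos_subset {μ : Ordinal.{0}} {w : RawBiworld Atom Agent (μ + 1)}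
    (h : w ∈ biworlds (μ + 1)) (A : Agent) : w.pos A ⊆ biworlds μ := fun _ hx =>
  ((mem_biworlds_succ w).1 h).1 A ▸ Or.inl hx

theorem neg_subset {μ : Ordinal.{0}} {w : RawBiworld Atom Agent (μ + 1)}
    (h : w ∈ biworlds (μ + 1)) (A : Agent) : w.neg A ⊆ biworlds μ := fun _ hx =>
  ((mem_biworlds_succ w).1 h).1 A ▸ Or.inr hx

theorem mem_pos_or_neg {μ : Ordinal.{0}} {w : RawBiworld Atom Agent (μ + 1)}
    (h : w ∈ biworlds (μ + 1)) (A : Agent) {x : RawBiworld Atom Agent μ} (hx : x ∈ biworlds μ) :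
    x ∈ w.pos A ∨ x ∈ w.neg A := by
  rw [← ((mem_biworlds_succ w).1 h).1 A] at hx
  exact hx

theorem mem_biworlds_limit_iff {l : Ordinal.{0}} (hl : Order.IsSuccLimit l)
    {w : RawBiworld Atom Agent l} (hw : IsPrebiworld w) :
    w ∈ biworlds l ↔ ∀ (α : Ordinal.{0}) (hα : α < l), restr α hα.le w ∈ biworlds α := by
  rw [mem_biworlds_limit hl]
  refine ⟨fun h α hα => restr_eq_elem hl hw α hα ▸ h.2 α hα, fun h => ⟨hw, fun α hα => ?_⟩⟩
  rw [← restr_eq_elem hl hw α hα]; exact h α hα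

/-- A coherent sequence of prebiworlds is a prebiworld of limit depth. -/
theorem exists_limit {l : Ordinal.{0}} (hl : Order.IsSuccLimit l)
    (s : ∀ α : Ordinal.{0}, α < l → RawBiworld Atom Agent α)
    (hs : ∀ α hα, IsPrebiworld (s α hα))
    (hc : ∀ γ α (h : γ ≤ α) (hα : α < l), restr γ h (s α hα) = s γ (h.trans_lt hα)) :
    ∃ w : RawBiworld Atom Agent l, IsPrebiworld w ∧ ∀ α (hα : α < l), restr α hα.le w = s α hα := by
  have he : ∀ α hα, elem hl ((limEquiv l hl).symm s) α hα = s α hα := fun α hα => by simp [elem]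
  have hp : IsPrebiworld ((limEquiv l hl).symm s) := by
    rw [isPrebiworld_limit hl]
    exact ⟨fun α hα => by rw [he]; exact hs α hα, fun γ α h hα => by rw [he, he, hc]⟩
  exact ⟨_, hp, fun α hα => by rw [restr_eq_elem hl hp, he]⟩

/-- Prebiworlds of limit depth are determined by their restrictions. -/
theorem limit_ext_restr {l : Ordinal.{0}} (hl : Order.IsSuccLimit l) {w w' : RawBiworld Atom Agent l}
    (hw : IsPrebiworld w) (hw' : IsPrebiworld w')
    (h : ∀ γ (hγ : γ < l), restr γ hγ.le w = restr γ hγ.le w') : w = w' :=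
  limit_ext hl fun γ hγ => by
    rw [← restr_eq_elem hl hw, ← restr_eq_elem hl hw', h γ hγ]

end RawBiworld

-- Two-colourings and dense partitions of ultrametric spaces.

section Combinatorics

variable {X : Type*} {Y : ℕ → Type*}

/-- Two-colouring of a set `D` for a separating decreasing sequence of equivalence relations
(given as the kernels of the maps `f n`): every class meeting `D` in at least two points contains
points of `D` of both colours. -/
theorem exists_two_coloring (f : ∀ n, X → Y n)
    (hmono : ∀ m n, m ≤ n → ∀ x y, f n x = f n y → f m x = f m y)
    (hsep : ∀ x y, (∀ n, f n x = f n y) → x = y) (D : Set X) :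
    ∃ c : Set X, ∀ n, ∀ x ∈ D, (∃ y ∈ D, y ≠ x ∧ f n y = f n x) →
      (∃ a ∈ D, f n a = f n x ∧ a ∈ c) ∧ (∃ a ∈ D, f n a = f n x ∧ a ∉ c) := by
  classical
  -- An arbitrary well-order; `M n x` will be the least point of `D` in the level-`n` ball of `x`.
  obtain ⟨_, hwf⟩ := exists_wellFoundedLT X
  have hM : ∀ n x, x ∈ D → ∃ m ∈ D, f n m = f n x ∧ ∀ y ∈ D, f n y = f n x → m ≤ y := by
    intro n x hx
    obtain ⟨m, hm, hmin⟩ := hwf.wf.has_min {y | y ∈ D ∧ f n y = f n x} ⟨x, hx, rfl⟩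
    exact ⟨m, hm.1, hm.2, fun y hy hyx => not_lt.1 (hmin y ⟨hy, hyx⟩)⟩
  choose! M hMD hMf hMle using hM
  have hMeq : ∀ n x y, x ∈ D → y ∈ D → f n x = f n y → M n x = M n y := fun n x y hx hy h =>
    le_antisymm (hMle n x hx _ (hMD n y hy) ((hMf n y hy).trans h.symm))
      (hMle n y hy _ (hMD n x hx) ((hMf n x hx).trans h))
  have hMstay : ∀ n x, x ∈ D → M n x = x → ∀ k, n ≤ k → M k x = x := fun n x hx h k hk =>
    le_antisymm (hMle k x hx x hx rfl)
      (h.symm.le.trans (hMle n x hx _ (hMD k x hx) (hmono n k hk _ _ (hMf k x hx))))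
  -- The levels at which the least point changes as the balls around `x` shrink; the colour is the
  -- parity of their number. `ncard` is 0 on infinite sets, but parity is only compared at points
  -- where this set is finite.
  let K : X → Set ℕ := fun x => {k | M k x ≠ M (k + 1) x}
  refine ⟨{x | Even (K x).ncard}, fun n x hx ⟨y, hy, hyx, hfy⟩ => ?_⟩
  obtain ⟨m, hm, hmn, hmx, z, hz, hzm, hzx⟩ : ∃ m ∈ D, M n m = m ∧ f n m = f n x ∧
      ∃ z ∈ D, z ≠ m ∧ f n z = f n m := by
    refine ⟨M n x, hMD n x hx, hMeq n _ _ (hMD n x hx) hx (hMf n x hx), hMf n x hx, ?_⟩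
    by_cases h : x = M n x
    · exact ⟨y, hy, fun e => hyx (e.trans h.symm), hfy.trans (hMf n x hx).symm⟩
    · exact ⟨x, hx, h, (hMf n x hx).symm⟩
  have hex : ∃ k, f k z ≠ f k m := by
    by_contra! h
    exact hzm (hsep _ _ h)
  obtain ⟨j, hj⟩ : ∃ j, Nat.find hex = j + 1 := by
    refine Nat.exists_eq_succ_of_ne_zero fun h0 => Nat.find_spec hex ?_
    rw [h0]
    exact hmono 0 n n.zero_le _ _ hzx
  have hj1 : f (j + 1) z ≠ f (j + 1) m := hj ▸ Nat.find_spec hex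
  have hjz : f j z = f j m := not_not.1 (Nat.find_min hex (by omega))
  have hnj : n ≤ j := by
    by_contra! h
    exact hj1 (hmono _ _ h _ _ hzx)
  -- The least point of the ball of `z` just after `z` separates from `m`. Up to level `j` the
  -- points `m` and `m'` have the same least points; from then on each is least in its own balls. So
  -- `K m'` is `K m` with `j` added, and the colours differ.
  set m' := M (j + 1) z with hm'
  have hm'D : m' ∈ D := hMD _ z hz
  have hm'z : f (j + 1) m' = f (j + 1) z := hMf _ z hz
  have hm'm : ∀ k ≤ j, f k m' = f k m := fun k hk =>
    (hmono k (j + 1) (by omega) _ _ hm'z).trans (hmono k j hk _ _ hjz)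
  have hm'fix : ∀ k, j + 1 ≤ k → M k m' = m' :=
    hMstay _ _ hm'D (hMeq _ _ _ hm'D hz hm'z)
  have hmfix : ∀ k, n ≤ k → M k m = m := hMstay _ _ hm hmn
  have hne : m ≠ m' := fun e => hj1 (by rw [← hm'z, ← e])
  have hK : K m' = insert j (K m) := by
    ext k
    simp only [K, Set.mem_insert_iff, Set.mem_ofPred_eq]
    rcases lt_trichotomy k j with h | rfl | h
    · rw [hMeq k m' m hm'D hm (hm'm k h.le), hMeq (k + 1) m' m hm'D hm (hm'm _ h)]
      simp [h.ne]
    · rw [hMeq k m' m hm'D hm (hm'm k le_rfl), hm'fix _ le_rfl, hmfix k hnj]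
      simp [hne]
    · rw [hm'fix k h, hm'fix (k + 1) (by omega), hmfix k (by omega), hmfix (k + 1) (by omega)]
      simp [h.ne']
  have hjK : j ∉ K m := by simp [K, hmfix j hnj, hmfix (j + 1) (by omega)]
  have hfin : (K m).Finite := (Set.finite_Iio n).subset fun k hk => by
    by_contra h
    rw [Set.mem_Iio, not_lt] at h
    exact hk (by rw [hmfix k h, hmfix (k + 1) (by omega)])
  have hcard : (K m').ncard = (K m).ncard + 1 := by
    rw [hK, Set.ncard_insert_of_notMem hjK hfin]
  have hm'x : f n m' = f n x := (hm'm n hnj).trans hmx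
  by_cases he : Even (K m).ncard
  · exact ⟨⟨m, hm, hmx, he⟩, m', hm'D, hm'x, by simp [hcard, Nat.even_add_one, he]⟩
  · exact ⟨⟨m', hm'D, hm'x, by simp [hcard, Nat.even_add_one, he]⟩, m, hm, hmx, he⟩

/-- If `P` and `N` cover an ultrametric space and no point of `P ∩ N` is isolated, then the space
can be partitioned into a dense subset of `P` and a dense subset of `N`. -/
theorem exists_dense_partition (f : ∀ n, X → Y n)
    (hmono : ∀ m n, m ≤ n → ∀ x y, f n x = f n y → f m x = f m y)
    (hsep : ∀ x y, (∀ n, f n x = f n y) → x = y) (P N : Set X) (hPN : ∀ x, x ∈ P ∨ x ∈ N)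
    (hacc : ∀ x ∈ P, x ∈ N → ∀ n, ∃ y, y ≠ x ∧ f n y = f n x) :
    ∃ Q : Set X, Q ⊆ P ∧ Qᶜ ⊆ N ∧ (∀ x ∈ P, ∀ n, ∃ y ∈ Q, f n y = f n x) ∧
      (∀ x ∈ N, ∀ n, ∃ y, y ∉ Q ∧ f n y = f n x) := by
  obtain ⟨c, hc⟩ := exists_two_coloring f hmono hsep (P ∩ N)
  let iso : Set X := {x | ∃ n, ∀ y ∈ P ∩ N, f n y = f n x → y = x}
  -- A point isolated in `P ∩ N` goes to the `P` side when `P` lies inside `N` nearby, since no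
  -- point of `P` outside `N` can then stand in for it. The other points follow the colouring.
  let white : Set X := {x | (x ∈ iso ∧ ∃ n, ∀ y ∈ P, f n y = f n x → y ∈ N) ∨ (x ∉ iso ∧ x ∈ c)}
  refine ⟨{x | x ∈ P ∧ (x ∈ N → x ∈ white)}, fun x hx => hx.1, fun x hx => ?_,
    fun x hx n => ?_, fun x hx n => ?_⟩
  · by_contra h
    exact hx ⟨(hPN x).resolve_right h, fun h' => absurd h' h⟩
  · by_cases h : ∃ y ∈ P, f n y = f n x ∧ y ∉ N
    · obtain ⟨y, hy, hyx, hyN⟩ := h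
      exact ⟨y, ⟨hy, fun h => absurd h hyN⟩, hyx⟩
    push Not at h
    by_cases hi : ∃ y ∈ P ∩ N, f n y = f n x ∧ y ∈ iso
    · obtain ⟨y, hy, hyx, hyi⟩ := hi
      exact ⟨y, ⟨hy.1, fun _ => Or.inl ⟨hyi, n, fun z hz hzy => h z hz (hzy.trans hyx)⟩⟩, hyx⟩
    push Not at hi
    have hxN := h x hx rfl
    have hxi := hi x ⟨hx, hxN⟩ rfl
    simp only [iso, Set.mem_ofPred_eq] at hxi
    push Not at hxi
    obtain ⟨y, hy, hyx, hne⟩ := hxi n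
    obtain ⟨a, ha, hax, hac⟩ := (hc n x ⟨hx, hxN⟩ ⟨y, hy, hne, hyx⟩).1
    exact ⟨a, ⟨ha.1, fun _ => Or.inr ⟨hi a ha hax, hac⟩⟩, hax⟩
  · by_cases h : ∃ y ∈ N, f n y = f n x ∧ y ∉ P
    · obtain ⟨y, hy, hyx, hyP⟩ := h
      exact ⟨y, fun h => hyP h.1, hyx⟩
    push Not at h
    have hxP := h x hx rfl
    by_cases hi : ∃ y ∈ P ∩ N, f n y = f n x ∧ y ∈ iso
    · obtain ⟨y, hy, hyx, hyi⟩ := hi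
      refine ⟨y, fun hQ => ?_, hyx⟩
      rcases hQ.2 hy.2 with ⟨-, k, hk⟩ | ⟨hni, -⟩
      · obtain ⟨j, hj⟩ := hyi
        -- If `y` were white, `P` and `N` would coincide near `y`, so a point of `X` close to `y`
        -- would lie in `P ∩ N`, against isolation there.
        obtain ⟨z, hzy, hz⟩ := hacc y hy.1 hy.2 (max n (max k j))
        have hzP : z ∈ P := (hPN z).elim id fun hzN =>
          h z hzN ((hmono _ _ (by simp) _ _ hz).trans hyx)
        exact hzy (hj z ⟨hzP, hk z hzP (hmono _ _ (by simp) _ _ hz)⟩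
          (hmono _ _ (by simp) _ _ hz))
      · exact hni hyi
    push Not at hi
    have hxi := hi x ⟨hxP, hx⟩ rfl
    simp only [iso, Set.mem_ofPred_eq] at hxi
    push Not at hxi
    obtain ⟨y, hy, hyx, hne⟩ := hxi n
    obtain ⟨a, ha, hax, hac⟩ := (hc n x ⟨hxP, hx⟩ ⟨y, hy, hne, hyx⟩).2
    refine ⟨a, fun hQ => ?_, hax⟩
    rcases hQ.2 ha.2 with ⟨hai, -⟩ | ⟨-, h⟩
    · exact hi a ha hax hai
    · exact hac h

end Combinatorics

/-- A countable limit ordinal has a cofinal sequence above any given smaller ordinal. -/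
theorem exists_cofinal_sequence {l : Ordinal.{0}} (hc : (Set.Iio l).Countable)
    {α : Ordinal.{0}} (hα : α < l) :
    ∃ s : ℕ → Ordinal.{0}, s 0 = α ∧ Monotone s ∧ (∀ n, s n < l) ∧ ∀ γ < l, ∃ n, γ ≤ s n := by
  obtain ⟨g, hg⟩ := hc.exists_eq_range ⟨α, hα⟩
  have hgl : ∀ n, g n < l := fun n => by
    have : g n ∈ Set.Iio l := hg ▸ Set.mem_range_self n
    exact this
  refine ⟨fun n => Nat.rec α (fun n a => max a (g n)) n, rfl,
    monotone_nat_of_le_succ fun n => le_max_left _ _, fun n => ?_, fun γ hγ => ?_⟩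
  · induction n with
    | zero => exact hα
    | succ n ih => exact max_lt ih (hgl n)
  · obtain ⟨n, rfl⟩ : γ ∈ Set.range g := hg ▸ hγ
    exact ⟨n + 1, le_max_right _ _⟩

-- Extensions of biworlds and inheritance of incompletedness.

namespace RawBiworld

variable {Atom : Type u} {Agent : Type v}

/-- Biworlds of depth `μ` relate well to those of smaller depth: restrictions of biworlds are
biworlds, biworlds have extensions, and incompletedness is inherited by restrictions. -/
structure Coherent (Atom : Type u) (Agent : Type v) (μ : Ordinal.{0}) : Prop where
  restr_mem : ∀ (α : Ordinal.{0}) (h : α ≤ μ), ∀ w ∈ biworlds (Atom := Atom) (Agent := Agent) μ,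
    restr α h w ∈ biworlds α
  lift : ∀ (α : Ordinal.{0}) (h : α ≤ μ), ∀ x ∈ biworlds (Atom := Atom) (Agent := Agent) α,
    ∃ w ∈ biworlds μ, restr α h w = x
  incompleted_restr : ∀ (α : Ordinal.{0}) (h : α ≤ μ),
    ∀ w ∈ biworlds (Atom := Atom) (Agent := Agent) μ, Incompleted w → Incompleted (restr α h w)

theorem mk_mem_biworlds {μ : Ordinal.{0}} {a : Set Atom}
    {p n : Agent → Set (RawBiworld Atom Agent μ)} (hp : ∀ A, p A ⊆ biworlds μ)
    (hn : ∀ A, n A ⊆ biworlds μ) (hu : ∀ A, ∀ x ∈ biworlds μ, x ∈ p A ∨ x ∈ n A)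
    (hd : ∀ A, ∀ x ∈ p A, x ∈ n A → Incompleted x) : mk a p n ∈ biworlds (μ + 1) := by
  rw [mem_biworlds_succ, pos_mk, neg_mk]
  exact ⟨fun A => (Set.union_subset (hp A) (hn A)).antisymm fun x hx => hu A x hx, hd⟩

/-- A prebiworld that is decided on every element has at most one extension. -/
theorem eq_of_restr_eq_of_disjoint {μ : Ordinal.{0}} {w : RawBiworld Atom Agent (μ + 1)}
    (hd : ∀ A, Disjoint (w.pos A) (w.neg A)) {w₁ w₂ : RawBiworld Atom Agent (μ + 1 + 1)}
    (h₁ : w₁ ∈ biworlds (μ + 1 + 1)) (h₂ : w₂ ∈ biworlds (μ + 1 + 1))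
    (hr₁ : restr (μ + 1) (le_succ _) w₁ = w) (hr₂ : restr (μ + 1) (le_succ _) w₂ = w) :
    w₁ = w₂ := by
  -- An element possible in one extension and impossible in the other would restrict to an element
  -- that `w` leaves undecided.
  have key : ∀ {w₁ w₂ : RawBiworld Atom Agent (μ + 1 + 1)}, w₁ ∈ biworlds (μ + 1 + 1) →
      w₂ ∈ biworlds (μ + 1 + 1) → restr (μ + 1) (le_succ _) w₁ = w →
      restr (μ + 1) (le_succ _) w₂ = w → ∀ A, w₁.pos A ⊆ w₂.pos A ∧ w₁.neg A ⊆ w₂.neg A := by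
    intro w₁ w₂ h₁ h₂ hr₁ hr₂ A
    have hp : ∀ {w' : RawBiworld Atom Agent (μ + 1 + 1)}, restr (μ + 1) (le_succ _) w' = w →
        ∀ x ∈ w'.pos A, restr μ (le_succ μ) x ∈ w.pos A := by
      rintro w' rfl x hx
      rw [pos_restr_succ _ (le_succ μ)]; exact ⟨x, hx, rfl⟩
    have hn : ∀ {w' : RawBiworld Atom Agent (μ + 1 + 1)}, restr (μ + 1) (le_succ _) w' = w →
        ∀ x ∈ w'.neg A, restr μ (le_succ μ) x ∈ w.neg A := by
      rintro w' rfl x hx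
      rw [neg_restr_succ _ (le_succ μ)]; exact ⟨x, hx, rfl⟩
    refine ⟨fun x hx => ?_, fun x hx => ?_⟩
    · exact (mem_pos_or_neg h₂ A (pos_subset h₁ A hx)).resolve_right fun h =>
        Set.disjoint_left.1 (hd A) (hp hr₁ x hx) (hn hr₂ x h)
    · exact (mem_pos_or_neg h₂ A (neg_subset h₁ A hx)).resolve_left fun h =>
        Set.disjoint_left.1 (hd A) (hp hr₂ x h) (hn hr₁ x hx)
  refine succ_ext ?_ (fun A => ?_) (fun A => ?_)
  · rw [← obj_restr (le_succ (μ + 1)) (isPrebiworld_of_mem h₁), hr₁, ← hr₂,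
      obj_restr _ (isPrebiworld_of_mem h₂)]
  · exact (key h₁ h₂ hr₁ hr₂ A).1.antisymm (key h₂ h₁ hr₂ hr₁ A).1
  · exact (key h₁ h₂ hr₁ hr₂ A).2.antisymm (key h₂ h₁ hr₂ hr₁ A).2

theorem not_incompleted_of_disjoint {μ : Ordinal.{0}} {w : RawBiworld Atom Agent (μ + 1)}
    (hd : ∀ A, Disjoint (w.pos A) (w.neg A)) : ¬ Incompleted w := by
  rw [incompleted_iff]
  rintro ⟨w₁, h₁, w₂, h₂, hne, hr₁, hr₂⟩
  exact hne (eq_of_restr_eq_of_disjoint hd h₁ h₂ hr₁ hr₂)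

/-- The extension of `y` in which, above an element `x` on which `y` is undecided, only the
extension `c x` is possible. -/
noncomputable def splitExt {μ : Ordinal.{0}}
    (c : RawBiworld Atom Agent μ → RawBiworld Atom Agent (μ + 1))
    (y : RawBiworld Atom Agent (μ + 1)) : RawBiworld Atom Agent (μ + 1 + 1) :=
  mk y.obj
    (fun A => {z | z ∈ biworlds (μ + 1) ∧ restr μ (le_succ μ) z ∈ y.pos A ∧
      (restr μ (le_succ μ) z ∈ y.neg A → z = c (restr μ (le_succ μ) z))})
    (fun A => {z | z ∈ biworlds (μ + 1) ∧ restr μ (le_succ μ) z ∈ y.neg A ∧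
      (restr μ (le_succ μ) z ∈ y.pos A → z ≠ c (restr μ (le_succ μ) z))})

theorem splitExt_disjoint {μ : Ordinal.{0}}
    (c : RawBiworld Atom Agent μ → RawBiworld Atom Agent (μ + 1))
    (y : RawBiworld Atom Agent (μ + 1)) (A : Agent) :
    Disjoint ((splitExt c y).pos A) ((splitExt c y).neg A) := by
  rw [splitExt, pos_mk, neg_mk, Set.disjoint_left]
  rintro z ⟨-, hp, h⟩ ⟨-, hn, h'⟩
  exact h' hp (h hn)

theorem splitExt_mem {μ : Ordinal.{0}}
    (hR : ∀ w ∈ biworlds (Atom := Atom) (Agent := Agent) (μ + 1),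
      restr μ (le_succ μ) w ∈ biworlds μ)
    (c : RawBiworld Atom Agent μ → RawBiworld Atom Agent (μ + 1))
    {y : RawBiworld Atom Agent (μ + 1)} (hy : y ∈ biworlds (μ + 1)) :
    splitExt c y ∈ biworlds (μ + 1 + 1) := by
  refine mk_mem_biworlds (fun A z hz => hz.1) (fun A z hz => hz.1) (fun A z hz => ?_)
    fun A z hz hz' => absurd (hz.2.2 hz'.2.1) (hz'.2.2 hz.2.1)
  simp only [Set.mem_ofPred_eq, hz, true_and]
  have := mem_pos_or_neg hy A (hR z hz)
  tauto

/-- Above an undecided `x`, the possible side retains `c x`. The impossible side retains some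
extension too, because `x` is incompleted and so has an extension other than `c x`. -/
theorem restr_splitExt {μ : Ordinal.{0}}
    {c : RawBiworld Atom Agent μ → RawBiworld Atom Agent (μ + 1)}
    (hc : ∀ x ∈ biworlds μ, c x ∈ biworlds (μ + 1) ∧ restr μ (le_succ μ) (c x) = x)
    {y : RawBiworld Atom Agent (μ + 1)} (hy : y ∈ biworlds (μ + 1)) :
restr (μ + 1) (le_succ _) (splitExt c y) = y := by
  refine succ_ext ?_ (fun A => ?_) (fun A => ?_)
  · rw [restr_succ_succ, obj_mk, splitExt, obj_mk]
  · rw [pos_restr_succ _ (le_succ μ), splitExt, pos_mk]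
    ext x
    constructor
    · rintro ⟨z, hz, rfl⟩; exact hz.2.1
    · intro hx
      obtain ⟨h1, h2⟩ := hc x (pos_subset hy A hx)
      exact ⟨c x, ⟨h1, by rwa [h2], by rw [h2]; exact fun _ => rfl⟩, h2⟩
  · rw [neg_restr_succ _ (le_succ μ), splitExt, neg_mk]
    ext x
    constructor
    · rintro ⟨z, hz, rfl⟩; exact hz.2.1
    · intro hx
      obtain ⟨h1, h2⟩ := hc x (neg_subset hy A hx)
      by_cases hp : x ∈ y.pos A
      · obtain ⟨w₁, hw₁, w₂, hw₂, hne, hr₁, hr₂⟩ :=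
          (incompleted_iff x).1 (((mem_biworlds_succ y).1 hy).2 A x hp hx)
        by_cases he : w₁ = c x
        · exact ⟨w₂, ⟨hw₂, by rwa [hr₂], fun _ => by rw [hr₂, ← he]; exact hne.symm⟩, hr₂⟩
        · exact ⟨w₁, ⟨hw₁, by rwa [hr₁], fun _ => by rwa [hr₁]⟩, hr₁⟩
      · exact ⟨c x, ⟨h1, by rwa [h2], by rw [h2]; exact fun h => absurd h hp⟩, h2⟩

/-- A successor biworld that is undecided on some element is incompleted. -/
theorem incompleted_of_mem {μ : Ordinal.{0}} (hC : Coherent Atom Agent (μ + 1))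
    {y : RawBiworld Atom Agent (μ + 1)} (hy : y ∈ biworlds (μ + 1)) {A : Agent}
    {x : RawBiworld Atom Agent μ} (hp : x ∈ y.pos A) (hn : x ∈ y.neg A) : Incompleted y := by
  classical
  have hR := hC.restr_mem μ (le_succ μ)
  have hS := hC.lift μ (le_succ μ)
  have : Nonempty (RawBiworld Atom Agent (μ + 1)) := ⟨y⟩
  choose! c hc using hS
  obtain ⟨w₁, hw₁, w₂, hw₂, hne, hr₁, hr₂⟩ :=
    (incompleted_iff x).1 (((mem_biworlds_succ y).1 hy).2 A x hp hn)
  have key : ∀ w ∈ biworlds (μ + 1), restr μ (le_succ μ) w = x →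
      (∀ z ∈ biworlds μ, Function.update c x w z ∈ biworlds (μ + 1) ∧
        restr μ (le_succ μ) (Function.update c x w z) = z) := by
    rintro w hw hr z hz
    by_cases h : z = x
    · subst h; simpa using ⟨hw, hr⟩
    · simpa [h] using hc z hz
  -- Two splittings whose selections differ only at `x`: one makes `w₁` possible, the other `w₂`.
  refine (incompleted_iff y).2 ⟨_, splitExt_mem hR (Function.update c x w₁) hy, _,
    splitExt_mem hR (Function.update c x w₂) hy, fun he => ?_,
    restr_splitExt (key w₁ hw₁ hr₁) hy, restr_splitExt (key w₂ hw₂ hr₂) hy⟩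
  have h1 : w₁ ∈ (splitExt (Function.update c x w₁) y).pos A := by
    rw [splitExt, pos_mk]
    exact ⟨hw₁, by rwa [hr₁], by simp [hr₁]⟩
  rw [he, splitExt, pos_mk] at h1
  have := h1.2.2 (by rwa [hr₁])
  rw [hr₁, Function.update_self] at this
  exact hne this

/-- Distinct biworlds with the same restriction witness that the restriction is incompleted. -/
theorem incompleted_of_restr_eq {μ : Ordinal.{0}} (hC : ∀ ν ≤ μ, Coherent Atom Agent ν)
    {w w' : RawBiworld Atom Agent μ} (hw : w ∈ biworlds μ) (hw' : w' ∈ biworlds μ) (hne : w ≠ w')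
    {α : Ordinal.{0}} (h : α ≤ μ) (he : restr α h w = restr α h w') :
    Incompleted (restr α h w) := by
  have hpw := isPrebiworld_of_mem hw
  have hpw' := isPrebiworld_of_mem hw'
  by_contra hi
  -- A first disagreement above `α` can only occur at some `β + 1`. The common restriction to `β` is
  -- then incompleted, and so is its restriction to `α`.
  suffices H : ∀ β (hβ : β ≤ μ), restr β hβ w = restr β hβ w' from
    hne (by simpa only [restr_self _ hpw, restr_self _ hpw'] using H μ le_rfl)
  intro β hβ
  rcases le_or_gt β α with hβα | hαβ
  · rw [← restr_restr hβα h hpw, he, restr_restr _ _ hpw']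
  induction β using Ordinal.limitRecOn with
  | zero => simp at hαβ
  | add_one β ih =>
    have hβ' : β ≤ μ := (le_succ β).trans hβ
    have hαβ' : α ≤ β := by simpa using hαβ
    have ih' : restr β hβ' w = restr β hβ' w' := by
      rcases hαβ'.eq_or_lt with rfl | h
      · exact he
      · exact ih hβ' h
    by_contra hneq
    apply hi
    rw [← restr_restr hαβ' hβ' hpw]
    refine (hC β hβ').incompleted_restr α hαβ' _ ((hC μ le_rfl).restr_mem _ _ _ hw)
      ((incompleted_iff _).2 ⟨_, (hC μ le_rfl).restr_mem _ hβ _ hw, _,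
        (hC μ le_rfl).restr_mem _ hβ _ hw', hneq, restr_restr _ _ hpw, ?_⟩)
    rw [restr_restr _ _ hpw', ih']
  | limit l hl ih =>
    refine limit_ext_restr hl (hpw.restr _) (hpw'.restr _) fun γ hγ => ?_
    rw [restr_restr _ _ hpw, restr_restr _ _ hpw']
    rcases le_or_gt γ α with hγα | hαγ
    · rw [← restr_restr hγα h hpw, he, restr_restr _ _ hpw']
    · exact ih γ hγ _ hαγ

/-- An element undecided after restriction comes either from a single undecided element, whose
incompletedness is inherited, or from two distinct biworlds with the same restriction, where
`incompleted_of_restr_eq` applies. -/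
theorem restr_mem_of_succ {μ : Ordinal.{0}} (hC : ∀ ν ≤ μ, Coherent Atom Agent ν)
    {w : RawBiworld Atom Agent (μ + 1)} (hw : w ∈ biworlds (μ + 1)) (γ : Ordinal.{0})
    (hγ : γ ≤ μ) : restr γ (hγ.trans (le_succ μ)) w ∈ biworlds γ := by
  have hpw := isPrebiworld_of_mem hw
  induction γ using Ordinal.limitRecOn with
  | zero => exact mem_biworlds_zero _
  | add_one α _ =>
    have hα : α ≤ μ := (le_succ α).trans hγ
    rw [restr_succ_succ]
    refine mk_mem_biworlds ?_ ?_ ?_ ?_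
    · rintro A _ ⟨v, hv, rfl⟩
      exact (hC μ le_rfl).restr_mem _ _ _ (pos_subset hw A hv)
    · rintro A _ ⟨v, hv, rfl⟩
      exact (hC μ le_rfl).restr_mem _ _ _ (neg_subset hw A hv)
    · intro A x hx
      obtain ⟨v, hv, rfl⟩ := (hC μ le_rfl).lift α hα x hx
      exact (mem_pos_or_neg hw A hv).imp (fun h => ⟨v, h, rfl⟩) fun h => ⟨v, h, rfl⟩
    · rintro A _ ⟨v, hv, rfl⟩ ⟨v', hv', he⟩
      by_cases h : v = v'
      · subst h
        exact (hC μ le_rfl).incompleted_restr _ _ _ (pos_subset hw A hv)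
          (((mem_biworlds_succ w).1 hw).2 A v hv hv')
      · exact incompleted_of_restr_eq hC (pos_subset hw A hv) (neg_subset hw A hv') h hα he.symm
  | limit l hl ih =>
    refine (mem_biworlds_limit_iff hl (hpw.restr _)).2 fun α hα => ?_
    rw [restr_restr _ _ hpw]
    exact ih α hα (hα.le.trans hγ)

/-- Shrinking the sets of possible and impossible elements preserves the restriction if no
restriction of an element to a smaller depth is lost. -/
theorem shrink_mem {μ : Ordinal.{0}} {w : RawBiworld Atom Agent (μ + 1)}
    (hw : w ∈ biworlds (μ + 1)) (hr : restr μ (le_succ μ) w ∈ biworlds μ)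
    {p n : Agent → Set (RawBiworld Atom Agent μ)} (hp : ∀ B, p B ⊆ w.pos B)
    (hn : ∀ B, n B ⊆ w.neg B) (hu : ∀ B, ∀ x ∈ biworlds μ, x ∈ p B ∨ x ∈ n B)
    (hp' : ∀ α (hα : α < μ), ∀ B, ∀ y ∈ w.pos B, ∃ z ∈ p B, restr α hα.le z = restr α hα.le y)
    (hn' : ∀ α (hα : α < μ), ∀ B, ∀ y ∈ w.neg B, ∃ z ∈ n B, restr α hα.le z = restr α hα.le y) :
    mk w.obj p n ∈ biworlds (μ + 1) ∧
      restr μ (le_succ μ) (mk w.obj p n) = restr μ (le_succ μ) w := by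
  have hpw := isPrebiworld_of_mem hw
  refine ⟨mk_mem_biworlds (fun B => (hp B).trans (pos_subset hw B))
    (fun B => (hn B).trans (neg_subset hw B)) hu
    fun B y hy hy' => ((mem_biworlds_succ w).1 hw).2 B y (hp B hy) (hn B hy'),
    restr_eq_of_image_eq (isPrebiworld_of_mem hr) ?_ (fun α hα B => ?_) (fun α hα B => ?_)⟩
  · rw [obj_mk, obj_restr _ hpw]
  · rw [restr_restr _ _ hpw, pos_restr_succ _ ((le_succ α).trans hα), pos_mk]
    refine (Set.image_mono (hp B)).antisymm ?_
    rintro _ ⟨y, hy, rfl⟩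
    exact hp' α (Order.add_one_le_iff.1 hα) B y hy
  · rw [restr_restr _ _ hpw, neg_restr_succ _ ((le_succ α).trans hα), neg_mk]
    refine (Set.image_mono (hn B)).antisymm ?_
    rintro _ ⟨y, hy, rfl⟩
    exact hn' α (Order.add_one_le_iff.1 hα) B y hy

theorem exists_mem_of_incompleted {μ : Ordinal.{0}} {w : RawBiworld Atom Agent (μ + 1)}
    (hw : Incompleted w) : ∃ A, ∃ x ∈ w.pos A, x ∈ w.neg A := by
  by_contra! h
  exact not_incompleted_of_disjoint (fun A => Set.disjoint_left.2 (h A)) hw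

/-- A biworld is not determined by an incompleted restriction. -/
theorem exists_ne_of_incompleted {μ : Ordinal.{0}} (hC : Coherent Atom Agent μ)
    {α : Ordinal.{0}} (hα : α < μ) {x : RawBiworld Atom Agent μ}
    (hi : Incompleted (restr α hα.le x)) :
    ∃ y ∈ biworlds μ, y ≠ x ∧ restr α hα.le y = restr α hα.le x := by
  have hα' : α + 1 ≤ μ := Order.add_one_le_iff.2 hα
  obtain ⟨w₁, hw₁, w₂, hw₂, hne, hr₁, hr₂⟩ := (incompleted_iff _).1 hi
  have key : ∀ w ∈ biworlds (α + 1), restr α (le_succ α) w = restr α hα.le x →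
      w ≠ restr (α + 1) hα' x → ∃ y ∈ biworlds μ, y ≠ x ∧ restr α hα.le y = restr α hα.le x := by
    intro w hw hr hwx
    obtain ⟨y, hy, rfl⟩ := hC.lift _ hα' w hw
    refine ⟨y, hy, fun h => hwx (by rw [h]), ?_⟩
    rw [← hr, restr_restr _ _ (isPrebiworld_of_mem hy)]
  by_cases h : w₁ = restr (α + 1) hα' x
  · exact key w₂ hw₂ hr₂ fun h' => hne (h.trans h'.symm)
  · exact key w₁ hw₁ hr₁ h

/-- Let `w` be undecided at `x`. Then `x` is approximated by other biworlds, all on the possible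
side or all on the impossible side. Deleting `x` from that side leaves the restriction to `μ`
unchanged and yields a second extension. -/
theorem incompleted_restr_succ {μ : Ordinal.{0}} (hC : ∀ ν ≤ μ, Coherent Atom Agent ν)
    {w : RawBiworld Atom Agent (μ + 1)} (hw : w ∈ biworlds (μ + 1)) (hi : Incompleted w) :
    Incompleted (restr μ (le_succ μ) w) := by
  classical
  obtain ⟨A, x, hp, hn⟩ := exists_mem_of_incompleted hi
  have hr := restr_mem_of_succ hC hw μ le_rfl
  have hx := pos_subset hw A hp
  have hix := ((mem_biworlds_succ w).1 hw).2 A x hp hn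
  -- If approximation failed on one side at `α` and on the other at `β`, the biworld other than `x`
  -- that agrees with it at depth `max α β` would lie on neither side.
  have hdich : (∀ α (hα : α < μ), ∃ y ∈ w.pos A, y ≠ x ∧ restr α hα.le y = restr α hα.le x) ∨
      (∀ α (hα : α < μ), ∃ y ∈ w.neg A, y ≠ x ∧ restr α hα.le y = restr α hα.le x) := by
    by_contra! h
    obtain ⟨⟨α, hα, h1⟩, β, hβ, h2⟩ := h
    obtain ⟨y, hy, hyx, he⟩ := exists_ne_of_incompleted (hC μ le_rfl) (max_lt hα hβ)
      ((hC μ le_rfl).incompleted_restr _ _ x hx hix)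
    have hpy := isPrebiworld_of_mem hy
    have hpx := isPrebiworld_of_mem hx
    rcases mem_pos_or_neg hw A hy with hy' | hy'
    · apply h1 y hy' hyx
      rw [← restr_restr (le_max_left α β) (max_lt hα hβ).le hpy, he, restr_restr _ _ hpx]
    · apply h2 y hy' hyx
      rw [← restr_restr (le_max_right α β) (max_lt hα hβ).le hpy, he, restr_restr _ _ hpx]
  have hsub : ∀ (S : Agent → Set (RawBiworld Atom Agent μ)) B,
      Function.update S A (S A \ {x}) B ⊆ S B := by
    intro S B
    by_cases hB : B = A
    · subst hB; simp
    · simp [hB]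
  have hsurj : ∀ (S : Agent → Set (RawBiworld Atom Agent μ)),
      (∀ α (hα : α < μ), ∃ y ∈ S A, y ≠ x ∧ restr α hα.le y = restr α hα.le x) →
      ∀ α (hα : α < μ), ∀ B, ∀ y ∈ S B, ∃ z ∈ Function.update S A (S A \ {x}) B,
        restr α hα.le z = restr α hα.le y := by
    intro S hS α hα B y hy
    by_cases hB : B = A
    · subst hB
      rw [Function.update_self]
      by_cases hyx : y = x
      · subst hyx
        obtain ⟨z, hz, hzx, he⟩ := hS α hα
        exact ⟨z, ⟨hz, hzx⟩, he⟩
      · exact ⟨y, ⟨hy, hyx⟩, rfl⟩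
    · exact ⟨y, by simpa [hB] using hy, rfl⟩
  rcases hdich with h | h
  · obtain ⟨hm, hr'⟩ := shrink_mem hw hr (hsub w.pos) (fun _ => subset_rfl) (fun B y hy => by
      by_cases hB : B = A
      · subst hB
        by_cases hyx : y = x
        · exact Or.inr (hyx ▸ hn)
        · simpa [hyx] using mem_pos_or_neg hw B hy
      · simpa [hB] using mem_pos_or_neg hw B hy) (hsurj w.pos h)
      (fun α hα B y hy => ⟨y, hy, rfl⟩)
    refine (incompleted_iff _).2 ⟨_, hw, _, hm, fun he => ?_, rfl, hr'⟩
    rw [he, pos_mk] at hp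
    simp at hp
  · obtain ⟨hm, hr'⟩ := shrink_mem hw hr (fun _ => subset_rfl) (hsub w.neg) (fun B y hy => by
      by_cases hB : B = A
      · subst hB
        by_cases hyx : y = x
        · exact Or.inl (hyx ▸ hp)
        · simpa [hyx] using mem_pos_or_neg hw B hy
      · simpa [hB] using mem_pos_or_neg hw B hy) (fun α hα B y hy => ⟨y, hy, rfl⟩)
      (hsurj w.neg h)
    refine (incompleted_iff _).2 ⟨_, hw, _, hm, fun he => ?_, rfl, hr'⟩
    rw [he, neg_mk] at hn
    simp at hn

/-- If the restriction to `α + 1` were undecided nowhere, each `l`-biworld would be decided by its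
restriction to `α`, and `w` would have at most one extension. So that restriction is undecided
somewhere, hence incompleted, and coherence at `α + 1` passes this on to `α`. -/
theorem incompleted_restr_limit {l : Ordinal.{0}} (hl : Order.IsSuccLimit l)
    (hC : ∀ ν < l, Coherent Atom Agent ν) {w : RawBiworld Atom Agent l} (hw : w ∈ biworlds l)
    (hi : Incompleted w) (α : Ordinal.{0}) (hα : α < l) : Incompleted (restr α hα.le w) := by
  obtain ⟨w₁, hw₁, w₂, hw₂, hne, hr₁, hr₂⟩ := (incompleted_iff _).1 hi
  have hpw := isPrebiworld_of_mem hw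
  have hα' : α + 1 < l := hl.add_one_lt hα
  have hmem : restr (α + 1) hα'.le w ∈ biworlds (α + 1) :=
    (mem_biworlds_limit_iff hl hpw).1 hw _ hα'
  have hlift : ∀ w' ∈ biworlds (l + 1), restr l (le_succ l) w' = w → ∀ A,
      (∀ x ∈ w'.pos A, restr α hα.le x ∈ (restr (α + 1) hα'.le w).pos A) ∧
      (∀ x ∈ w'.neg A, restr α hα.le x ∈ (restr (α + 1) hα'.le w).neg A) := by
    rintro w' hw' rfl A
    rw [restr_restr _ _ (isPrebiworld_of_mem hw'), pos_restr_succ _ hα.le, neg_restr_succ _ hα.le]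
    exact ⟨fun x hx => ⟨x, hx, rfl⟩, fun x hx => ⟨x, hx, rfl⟩⟩
  obtain ⟨A, x, hp, hn⟩ : ∃ A, ∃ x ∈ (restr (α + 1) hα'.le w).pos A,
      x ∈ (restr (α + 1) hα'.le w).neg A := by
    by_contra! h
    have key : ∀ w₁ ∈ biworlds (l + 1), ∀ w₂ ∈ biworlds (l + 1), restr l (le_succ l) w₁ = w →
        restr l (le_succ l) w₂ = w → ∀ A, w₁.pos A ⊆ w₂.pos A ∧ w₁.neg A ⊆ w₂.neg A := by
      intro w₁ hw₁ w₂ hw₂ hr₁ hr₂ A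
      refine ⟨fun x hx => ?_, fun x hx => ?_⟩
      · exact (mem_pos_or_neg hw₂ A (pos_subset hw₁ A hx)).resolve_right fun hx' =>
          h A _ ((hlift w₁ hw₁ hr₁ A).1 x hx) ((hlift w₂ hw₂ hr₂ A).2 x hx')
      · exact (mem_pos_or_neg hw₂ A (neg_subset hw₁ A hx)).resolve_left fun hx' =>
          h A _ ((hlift w₂ hw₂ hr₂ A).1 x hx') ((hlift w₁ hw₁ hr₁ A).2 x hx)
    refine hne (succ_ext ?_ (fun A => ?_) (fun A => ?_))
    · rw [← obj_restr (le_succ l) (isPrebiworld_of_mem hw₁), hr₁, ← hr₂,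
        obj_restr _ (isPrebiworld_of_mem hw₂)]
    · exact (key _ hw₁ _ hw₂ hr₁ hr₂ A).1.antisymm (key _ hw₂ _ hw₁ hr₂ hr₁ A).1
    · exact (key _ hw₁ _ hw₂ hr₁ hr₂ A).2.antisymm (key _ hw₂ _ hw₁ hr₂ hr₁ A).2
  have hin := incompleted_of_mem (hC _ hα') hmem hp hn
  rw [← restr_restr (le_succ α) hα'.le hpw]
  exact (hC _ hα').incompleted_restr _ _ _ hmem hin

end RawBiworld

-- Extensions at countable limit depth and coherence.

namespace RawBiworld

variable {Atom : Type u} {Agent : Type v}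

/-- In a family of sets of prebiworlds with surjective restrictions, elements can be extended to
countable limit depth. -/
theorem exists_limit_of_image_eq {l : Ordinal.{0}} (hl : Order.IsSuccLimit l)
    (hc : (Set.Iio l).Countable) (S : ∀ β : Ordinal.{0}, β < l → Set (RawBiworld Atom Agent β))
    (hp : ∀ β hβ, ∀ x ∈ S β hβ, IsPrebiworld x)
    (hS : ∀ β γ (h : β ≤ γ) (hγ : γ < l), S β (h.trans_lt hγ) = restr β h '' S γ hγ)
    {α : Ordinal.{0}} (hα : α < l) {x : RawBiworld Atom Agent α} (hx : x ∈ S α hα) :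
    ∃ v : RawBiworld Atom Agent l, IsPrebiworld v ∧ restr α hα.le v = x ∧
      ∀ β (hβ : β < l), restr β hβ.le v ∈ S β hβ := by
  obtain ⟨s, rfl, hmono, hsl, hcof⟩ := exists_cofinal_sequence hc hα
  have hstep : ∀ n (y : {y // y ∈ S (s n) (hsl n)}), ∃ z : {z // z ∈ S (s (n + 1)) (hsl (n + 1))},
      restr (s n) (hmono n.le_succ) z.1 = y.1 := by
    rintro n ⟨y, hy⟩
    rw [hS (s n) (s (n + 1)) (hmono n.le_succ) (hsl (n + 1))] at hy
    obtain ⟨z, hz, rfl⟩ := hy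
    exact ⟨⟨z, hz⟩, rfl⟩
  choose next hnext using hstep
  -- A thread along the cofinal sequence, which starts at depth `α` with `x`; the remaining depths
  -- are filled in by restriction.
  let t : ∀ n, {y // y ∈ S (s n) (hsl n)} := fun n => Nat.rec ⟨x, hx⟩ next n
  have htp : ∀ n, IsPrebiworld (t n).1 := fun n => hp _ _ _ (t n).2
  have ht : ∀ m n (h : m ≤ n), restr (s m) (hmono h) (t n).1 = (t m).1 := by
    intro m n h
    induction n, h using Nat.le_induction with
    | base => exact restr_self _ (htp m)
    | succ n h ih =>
      rw [← restr_restr (hmono h) (hmono n.le_succ) (htp (n + 1)), ← ih]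
      exact congrArg _ (hnext n (t n))
  choose! idx hidx using hcof
  let q : ∀ γ, γ < l → RawBiworld Atom Agent γ := fun γ hγ => restr γ (hidx γ hγ) (t (idx γ)).1
  have hq : ∀ n γ (h : γ ≤ s n) (hγ : γ < l), restr γ h (t n).1 = q γ hγ := by
    intro n γ h hγ
    rcases le_total n (idx γ) with hn | hn
    · rw [← ht _ _ hn, restr_restr _ _ (htp _)]
    · simp only [q]
      rw [← ht _ _ hn, restr_restr _ _ (htp _)]
  obtain ⟨v, hv, hvq⟩ := exists_limit hl q (fun γ hγ => (htp _).restr _) fun γ α h hα => by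
    rw [← hq (idx α) γ (h.trans (hidx α hα)) (h.trans_lt hα), ← restr_restr h (hidx α hα) (htp _)]
  refine ⟨v, hv, ?_, fun β hβ => ?_⟩
  · rw [hvq _ hα, ← hq 0 (s 0) le_rfl hα, restr_self _ (htp 0)]
    rfl
  · rw [hvq β hβ, hS β (s (idx β)) (hidx β hβ) (hsl _)]
    exact ⟨_, (t (idx β)).2, rfl⟩

theorem pos_restr_eq_image {μ : Ordinal.{0}} {w : RawBiworld Atom Agent μ} (hw : IsPrebiworld w)
    (A : Agent) {β γ : Ordinal.{0}} (h : β ≤ γ) (hγ : γ + 1 ≤ μ) :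
    (restr (β + 1) ((add_one_le_add_one h).trans hγ) w).pos A =
      restr β h '' (restr (γ + 1) hγ w).pos A := by
  rw [← restr_restr (add_one_le_add_one h) hγ hw, pos_restr_succ _ h]

theorem neg_restr_eq_image {μ : Ordinal.{0}} {w : RawBiworld Atom Agent μ} (hw : IsPrebiworld w)
    (A : Agent) {β γ : Ordinal.{0}} (h : β ≤ γ) (hγ : γ + 1 ≤ μ) :
    (restr (β + 1) ((add_one_le_add_one h).trans hγ) w).neg A =
      restr β h '' (restr (γ + 1) hγ w).neg A := by
  rw [← restr_restr (add_one_le_add_one h) hγ hw, neg_restr_succ _ h]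

/-- At countable limit depth, the biworlds can be divided into possible and impossible ones
in accordance with a given biworld `w`. -/
theorem exists_limit_partition {l : Ordinal.{0}} (hl : Order.IsSuccLimit l)
    (hc : (Set.Iio l).Countable) (hC : Coherent Atom Agent l)
    {w : RawBiworld Atom Agent l} (hw : w ∈ biworlds l) (A : Agent) :
    ∃ Q ⊆ biworlds (Atom := Atom) (Agent := Agent) l,
      (∀ α (hα : α < l), restr α hα.le '' Q = (restr (α + 1) (hl.add_one_lt hα).le w).pos A) ∧
      (∀ α (hα : α < l), restr α hα.le '' (biworlds l \ Q) =
        (restr (α + 1) (hl.add_one_lt hα).le w).neg A) := by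
  have hpw := isPrebiworld_of_mem hw
  obtain ⟨s, -, hmono, hsl, hcof⟩ := exists_cofinal_sequence hc
    (pos_iff_ne_zero.mpr hl.ne_bot : 0 < l)
  have hmem : ∀ α (hα : α < l), restr (α + 1) (hl.add_one_lt hα).le w ∈ biworlds (α + 1) :=
    fun α hα => hC.restr_mem _ _ _ hw
  let X := {v : RawBiworld Atom Agent l // v ∈ biworlds l}
  have hpX : ∀ x : X, IsPrebiworld x.1 := fun x => isPrebiworld_of_mem x.2
  -- The points all of whose restrictions `w` marks as possible; `N` is the analogue for impossible.
  -- They cover `X`, for failures at `α` and `β` would both show at `max α β`.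
  let P : Set X := {x | ∀ α (hα : α < l),
    restr α hα.le x.1 ∈ (restr (α + 1) (hl.add_one_lt hα).le w).pos A}
  let N : Set X := {x | ∀ α (hα : α < l),
    restr α hα.le x.1 ∈ (restr (α + 1) (hl.add_one_lt hα).le w).neg A}
  have hPN : ∀ x, x ∈ P ∨ x ∈ N := by
    intro x
    by_contra! h
    obtain ⟨hP, hN⟩ := h
    simp only [P, N, Set.mem_ofPred_eq] at hP hN
    push Not at hP hN
    obtain ⟨α, hα, h1⟩ := hP
    obtain ⟨β, hβ, h2⟩ := hN
    have hm := max_lt hα hβ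
    rcases mem_pos_or_neg (hmem _ hm) A (hC.restr_mem _ hm.le x.1 x.2) with h | h
    · apply h1
      rw [pos_restr_eq_image hpw A (le_max_left α β) (hl.add_one_lt hm).le]
      exact ⟨_, h, restr_restr _ _ (hpX x)⟩
    · apply h2
      rw [neg_restr_eq_image hpw A (le_max_right α β) (hl.add_one_lt hm).le]
      exact ⟨_, h, restr_restr _ _ (hpX x)⟩
  obtain ⟨Q, hQP, hQN, hQd, hQd'⟩ := exists_dense_partition
    (fun n (x : X) => restr (s n) (hsl n).le x.1)
    (fun m n h x y hxy => by
      rw [← restr_restr (hmono h) (hsl n).le (hpX x), hxy, restr_restr _ _ (hpX y)])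
    (fun x y h => Subtype.ext (limit_ext_restr hl (hpX x) (hpX y) fun γ hγ => by
      obtain ⟨n, hn⟩ := hcof γ hγ
      rw [← restr_restr hn (hsl n).le (hpX x), h n, restr_restr _ _ (hpX y)]))
    P N hPN (fun x hxP hxN n => by
      obtain ⟨y, hy, hyx, he⟩ := exists_ne_of_incompleted hC (hsl n)
        (((mem_biworlds_succ _).1 (hmem _ (hsl n))).2 A _ (hxP _ (hsl n)) (hxN _ (hsl n)))
      exact ⟨⟨y, hy⟩, fun h => hyx (congrArg Subtype.val h), he⟩)
  have hdense : ∀ (T R : Set X), (∀ x ∈ T, ∀ n, ∃ y ∈ R, restr (s n) (hsl n).le y.1 =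
      restr (s n) (hsl n).le x.1) → ∀ x ∈ T, ∀ α (hα : α < l), ∃ y ∈ R,
        restr α hα.le y.1 = restr α hα.le x.1 := by
    intro T R h x hx α hα
    obtain ⟨n, hn⟩ := hcof α hα
    obtain ⟨y, hy, he⟩ := h x hx n
    refine ⟨y, hy, ?_⟩
    rw [← restr_restr hn (hsl n).le (hpX y), he, restr_restr _ _ (hpX x)]
  refine ⟨Subtype.val '' Q, fun x ⟨y, _, h⟩ => h ▸ y.2, fun α hα => ?_, fun α hα => ?_⟩
  · ext x
    constructor
    · rintro ⟨_, ⟨y, hy, rfl⟩, rfl⟩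
      exact hQP hy α hα
    · intro hx
      -- The given element first extends to a point of `P`; density then replaces it by a point of
      -- `Q` with the same restriction to `α`.
      obtain ⟨v, hv, rfl, hvP⟩ := exists_limit_of_image_eq hl hc
        (fun β hβ => (restr (β + 1) (hl.add_one_lt hβ).le w).pos A)
        (fun β hβ x hx => isPrebiworld_of_mem (pos_subset (hmem β hβ) A hx))
        (fun β γ h hγ => pos_restr_eq_image hpw A h (hl.add_one_lt hγ).le) hα hx
      have hvm : v ∈ biworlds l := (mem_biworlds_limit_iff hl hv).2 fun β hβ =>
        pos_subset (hmem β hβ) A (hvP β hβ)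
      obtain ⟨y, hy, he⟩ := hdense P Q hQd ⟨v, hvm⟩ hvP α hα
      exact ⟨y.1, ⟨y, hy, rfl⟩, he⟩
  · ext x
    constructor
    · rintro ⟨y, ⟨hy, hyQ⟩, rfl⟩
      exact hQN (show (⟨y, hy⟩ : X) ∈ Qᶜ from fun h => hyQ ⟨_, h, rfl⟩) α hα
    · intro hx
      obtain ⟨v, hv, rfl, hvN⟩ := exists_limit_of_image_eq hl hc
        (fun β hβ => (restr (β + 1) (hl.add_one_lt hβ).le w).neg A)
        (fun β hβ x hx => isPrebiworld_of_mem (neg_subset (hmem β hβ) A hx))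
        (fun β γ h hγ => neg_restr_eq_image hpw A h (hl.add_one_lt hγ).le) hα hx
      have hvm : v ∈ biworlds l := (mem_biworlds_limit_iff hl hv).2 fun β hβ =>
        neg_subset (hmem β hβ) A (hvN β hβ)
      obtain ⟨y, hy, he⟩ := hdense N Qᶜ hQd' ⟨v, hvm⟩ hvN α hα
      exact ⟨y.1, ⟨y.2, fun ⟨z, hz, hzy⟩ => hy (Subtype.ext hzy ▸ hz)⟩, he⟩

/-- Every biworld of countable depth has an extension that is decided on every element. -/
theorem exists_decided_extension {μ : Ordinal.{0}} (hc : (Set.Iio μ).Countable)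
    (hC : Coherent Atom Agent μ) {w : RawBiworld Atom Agent μ} (hw : w ∈ biworlds μ) :
    ∃ w' ∈ biworlds (μ + 1), restr μ (le_succ μ) w' = w ∧
      ∀ A, Disjoint (w'.pos A) (w'.neg A) := by
  cases μ using Ordinal.limitRecOn with
  | zero =>
    refine ⟨mk w.obj (fun _ => biworlds 0) (fun _ => ∅), mk_mem_biworlds (fun _ => subset_rfl)
      (fun _ => Set.empty_subset _) (fun _ _ => Or.inl) (fun _ _ _ => False.elim),
      zero_ext (by rw [obj_restr_zero, obj_mk]), fun A => ?_⟩
    rw [neg_mk]; exact disjoint_bot_right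
  | add_one μ _ =>
    have : Nonempty (RawBiworld Atom Agent (μ + 1)) := ⟨w⟩
    have hS := hC.lift μ (le_succ μ)
    choose! c hc' using hS
    exact ⟨_, splitExt_mem (hC.restr_mem μ (le_succ μ)) c hw, restr_splitExt hc' hw,
      splitExt_disjoint c w⟩
  | limit l hl _ =>
    choose Q hQ hp hn using exists_limit_partition hl hc hC hw
    refine ⟨mk w.obj Q (fun A => biworlds _ \ Q A), mk_mem_biworlds hQ
      (fun A => Set.sdiff_subset) (fun A x hx => ?_) (fun A x hx hx' => absurd hx hx'.2),
      restr_eq_of_image_eq (isPrebiworld_of_mem hw) (obj_mk _ _ _) (fun α hα A => ?_)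
        (fun α hα A => ?_), fun A => ?_⟩
    · by_cases h : x ∈ Q A
      · exact Or.inl h
      · exact Or.inr ⟨hx, h⟩
    · rw [pos_mk]; exact hp A α (Order.add_one_le_iff.1 hα)
    · rw [neg_mk]; exact hn A α (Order.add_one_le_iff.1 hα)
    · rw [pos_mk, neg_mk]; exact Set.disjoint_sdiff_right

theorem Coherent.of_lt {μ : Ordinal.{0}}
    (h₁ : ∀ (α : Ordinal.{0}) (h : α < μ), ∀ w ∈ biworlds (Atom := Atom) (Agent := Agent) μ,
      restr α h.le w ∈ biworlds α)
    (h₂ : ∀ (α : Ordinal.{0}) (h : α < μ), ∀ x ∈ biworlds (Atom := Atom) (Agent := Agent) α,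
      ∃ w ∈ biworlds μ, restr α h.le w = x)
    (h₃ : ∀ (α : Ordinal.{0}) (h : α < μ), ∀ w ∈ biworlds (Atom := Atom) (Agent := Agent) μ,
      Incompleted w → Incompleted (restr α h.le w)) : Coherent Atom Agent μ := by
  refine ⟨fun α h w hw => ?_, fun α h x hx => ?_, fun α h w hw hi => ?_⟩
  · rcases h.eq_or_lt with rfl | h'
    · rwa [restr_self h (isPrebiworld_of_mem hw)]
    · exact h₁ α h' w hw
  · rcases h.eq_or_lt with rfl | h'
    · exact ⟨x, hx, restr_self h (isPrebiworld_of_mem hx)⟩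
    · exact h₂ α h' x hx
  · rcases h.eq_or_lt with rfl | h'
    · rwa [restr_self h (isPrebiworld_of_mem hw)]
    · exact h₃ α h' w hw hi

/-- The three clauses are proved together, as each needs the others at smaller depths. Extensions
exist at successors by `exists_decided_extension` and at limits by threads; both use countability.
-/
theorem coherent_of_countable (μ : Ordinal.{0}) (hc : (Set.Iio μ).Countable) :
    Coherent Atom Agent μ := by
  induction μ using WellFoundedLT.induction with
  | ind μ ih =>
  have ih' : ∀ ν < μ, Coherent Atom Agent ν := fun ν hν =>
    ih ν hν (hc.mono (Set.Iio_subset_Iio hν.le))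
  clear ih
  cases μ using Ordinal.limitRecOn with
  | zero =>
    exact .of_lt (fun α h => absurd h not_lt_zero) (fun α h => absurd h not_lt_zero)
      (fun α h => absurd h not_lt_zero)
  | add_one μ _ =>
    have hC : ∀ ν ≤ μ, Coherent Atom Agent ν := fun ν hν => ih' ν (Order.lt_add_one_iff.2 hν)
    refine .of_lt (fun α h w hw => restr_mem_of_succ hC hw α (Order.lt_add_one_iff.1 h))
      (fun α h x hx => ?_) (fun α h w hw hi => ?_)
    · obtain ⟨y, hy, rfl⟩ := (hC μ le_rfl).lift α (Order.lt_add_one_iff.1 h) x hx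
      obtain ⟨w, hw, rfl, -⟩ := exists_decided_extension
        (hc.mono (Set.Iio_subset_Iio (le_succ μ))) (hC μ le_rfl) hy
      exact ⟨w, hw, (restr_restr _ _ (isPrebiworld_of_mem hw)).symm⟩
    · rw [← restr_restr (Order.lt_add_one_iff.1 h) (le_succ μ) (isPrebiworld_of_mem hw)]
      exact (hC μ le_rfl).incompleted_restr _ _ _ (restr_mem_of_succ hC hw μ le_rfl)
        (incompleted_restr_succ hC hw hi)
  | limit l hl _ =>
    refine .of_lt
      (fun α h w hw => (mem_biworlds_limit_iff hl (isPrebiworld_of_mem hw)).1 hw α h)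
      (fun α h x hx => ?_) (fun α h w hw hi => incompleted_restr_limit hl ih' hw hi α h)
    obtain ⟨v, hv, hvx, hvm⟩ := exists_limit_of_image_eq hl hc (fun β _ => biworlds β)
      (fun β _ x hx => isPrebiworld_of_mem hx) (fun β γ h hγ => by
        ext y
        constructor
        · intro hy
          obtain ⟨z, hz, rfl⟩ := (ih' γ hγ).lift β h y hy
          exact ⟨z, hz, rfl⟩
        · rintro ⟨z, hz, rfl⟩
          exact (ih' γ hγ).restr_mem _ _ _ hz) h hx
    exact ⟨v, (mem_biworlds_limit_iff hl hv).2 hvm, hvx⟩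

end RawBiworld

theorem omegaSq_eq : omegaSq = Ordinal.omega0 * Ordinal.omega0 := by
  rw [omegaSq, ← one_add_one_eq_two, Ordinal.opow_add, Ordinal.opow_one]

theorem countable_Iio_omegaSq_add_one : (Set.Iio (omegaSq + 1)).Countable := by
  rw [← Cardinal.le_aleph0_iff_set_countable, Cardinal.mk_Iio_ordinal,
    Cardinal.lift_le_aleph0, omegaSq_eq]
  simp

-- Truth values under the two orders.

namespace TV

theorem leP_iff {a b : TV} : leP a b ↔ a = u ∨ a = b := by
  cases a <;> cases b <;> simp [leP]

theorem glbT_eq_t_iff {S : Set TV} : glbT S = t ↔ ∀ a ∈ S, a = t := by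
  unfold glbT
  split_ifs with h1 h2
  · exact ⟨fun h => (nomatch h), fun h => nomatch h f h1⟩
  · exact ⟨fun h => (nomatch h), fun h => nomatch h u h2⟩
  · refine ⟨fun _ a ha => ?_, fun _ => rfl⟩
    cases a <;> simp_all

theorem glbT_eq_f_iff {S : Set TV} : glbT S = f ↔ f ∈ S := by
  unfold glbT
  split_ifs <;> simp_all

theorem glbT_ne_u {S : Set TV} (h : ∀ a ∈ S, a ≠ u) : glbT S ≠ u := by
  unfold glbT
  split_ifs with h1 h2 <;> simp
  exact h _ h2 rfl

/-- The greatest lower bound for the truth order is monotone for the precision order. -/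
theorem leP_glbT {S T : Set TV} (hST : ∀ a ∈ S, ∃ b ∈ T, leP a b) (hTS : ∀ b ∈ T, ∃ a ∈ S, leP a b) :
    leP (glbT S) (glbT T) := by
  rw [leP_iff]
  cases h : glbT S
  · right
    rw [glbT_eq_t_iff] at h
    symm
    rw [glbT_eq_t_iff]
    intro b hb
    obtain ⟨a, ha, hab⟩ := hTS b hb
    have := h a ha
    subst this
    cases b <;> simp_all [leP]
  · right
    rw [glbT_eq_f_iff] at h
    symm
    rw [glbT_eq_f_iff]
    obtain ⟨b, hb, hab⟩ := hST _ h
    cases b <;> simp_all [leP]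
  · exact Or.inl rfl

theorem lubP_leP {S : Set TV} {a : TV} (h : ∀ b ∈ S, leP b a) : leP (lubP S) a := by
  unfold lubP
  split_ifs with h1 h2
  · exact h _ h1
  · exact h _ h2
  · exact leP_iff.2 (Or.inl rfl)

/-- Comparability rules out that `S` contains both `t` and `f`, where `lubP` would return `t`
without being an upper bound. -/
theorem leP_lubP {S : Set TV} (hS : ∀ a ∈ S, ∀ b ∈ S, leP a b ∨ leP b a) {a : TV} (ha : a ∈ S) :
    leP a (lubP S) :=
  (lubP_leP_iff S (fun h => by simpa [leP] using hS _ h.1 _ h.2) _).1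
    (leP_iff.2 (Or.inr rfl)) a ha

theorem leP_inv {a b : TV} (h : leP a b) : leP a.inv b.inv := by
  cases a <;> cases b <;> simp_all [leP, inv]

theorem inv_ne_u {a : TV} (h : a ≠ u) : a.inv ≠ u := by
  cases a <;> simp_all [inv]

theorem inv_eq_t_iff {a : TV} : a.inv = t ↔ a = f := by
  cases a <;> simp [inv]

end TV

-- Precision monotonicity and the depth at which formulas are decided.

namespace Formula

open RawBiworld

variable {Atom : Type u} {Agent : Type v}

/-- A valuation is precision monotone if passing to an extension preserves values `t` and `f`. -/
def PrecisionMono (g : ∀ μ : Ordinal.{0}, RawBiworld Atom Agent μ → TV) : Prop :=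
  ∀ (β : Ordinal.{0}) (w : RawBiworld Atom Agent β), IsPrebiworld w → ∀ α (h : α ≤ β),
    TV.leP (g α (restr α h w)) (g β w)

/-- A valuation is decided from depth `r` on if it takes only the values `t` and `f` there. -/
def DecidedFrom (r : Ordinal.{0}) (g : ∀ μ : Ordinal.{0}, RawBiworld Atom Agent μ → TV) : Prop :=
  ∀ μ, r ≤ μ → ∀ w : RawBiworld Atom Agent μ, IsPrebiworld w → g μ w ≠ TV.u

theorem DecidedFrom.mono {r s : Ordinal.{0}} {g : ∀ μ : Ordinal.{0}, RawBiworld Atom Agent μ → TV}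
    (h : DecidedFrom r g) (hrs : r ≤ s) : DecidedFrom s g :=
  fun μ hμ => h μ (hrs.trans hμ)

/-- The valuation obtained from a family of sets `S` at successor depths, with value `u` at depth
`0` and least upper bounds at limit depths. -/
def IsModal (S : ∀ μ : Ordinal.{0}, RawBiworld Atom Agent (μ + 1) → Set TV)
    (k : ∀ μ : Ordinal.{0}, RawBiworld Atom Agent μ → TV) : Prop :=
  (∀ w, k 0 w = TV.u) ∧ (∀ μ w, k (μ + 1) w = TV.glbT (S μ w)) ∧
    ∀ l, Order.IsSuccLimit l → ∀ w, IsPrebiworld w →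
      k l w = TV.lubP {x | ∃ (α : Ordinal.{0}) (hα : α < l), x = k α (restr α hα.le w)}

/-- Serves K_A and M_A alike. At a limit, the values at the restrictions form a chain by induction,
so `lubP` really bounds them. -/
theorem IsModal.precisionMono {S : ∀ μ : Ordinal.{0}, RawBiworld Atom Agent (μ + 1) → Set TV}
    {k : ∀ μ : Ordinal.{0}, RawBiworld Atom Agent μ → TV} (hk : IsModal S k)
    (hS : ∀ β (w : RawBiworld Atom Agent (β + 1)), IsPrebiworld w → ∀ α (h : α ≤ β),
      (∀ a ∈ S α (restr (α + 1) (add_one_le_add_one h) w), ∃ b ∈ S β w, TV.leP a b) ∧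
      ∀ b ∈ S β w, ∃ a ∈ S α (restr (α + 1) (add_one_le_add_one h) w), TV.leP a b) :
    PrecisionMono k := by
  intro β
  induction β using Ordinal.limitRecOn with
  | zero =>
    intro w hw α h
    obtain rfl : α = 0 := by simpa using h
    exact TV.leP_iff.2 (Or.inr (by rw [restr_self _ hw]))
  | add_one β _ =>
    intro w hw α h
    induction α using Ordinal.limitRecOn with
    | zero => exact TV.leP_iff.2 (Or.inl (hk.1 _))
    | add_one α _ =>
      rw [hk.2.1, hk.2.1]
      have := hS β w hw α (by simpa using h)
      exact TV.leP_glbT this.1 this.2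
    | limit l hl ih =>
      rw [hk.2.2 l hl _ (hw.restr h)]
      apply TV.lubP_leP
      rintro _ ⟨γ, hγ, rfl⟩
      rw [restr_restr _ _ hw]
      exact ih γ hγ _
  | limit l hl ih =>
    intro w hw α h
    rcases h.eq_or_lt with rfl | h'
    · exact TV.leP_iff.2 (Or.inr (by rw [restr_self _ hw]))
    rw [hk.2.2 l hl w hw]
    refine TV.leP_lubP ?_ ⟨α, h', rfl⟩
    rintro _ ⟨γ, hγ, rfl⟩ _ ⟨δ, hδ, rfl⟩
    rcases le_total γ δ with hγδ | hδγ
    · left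
      rw [← restr_restr hγδ hδ.le hw]
      exact ih δ hδ _ (hw.restr _) γ hγδ
    · right
      rw [← restr_restr hδγ hγ.le hw]
      exact ih γ hγ _ (hw.restr _) δ hδγ

/-- At depth `r + 1` the value is a bound of decided values; all greater depths, limits included,
inherit it by monotonicity. -/
theorem IsModal.decidedFrom {S : ∀ μ : Ordinal.{0}, RawBiworld Atom Agent (μ + 1) → Set TV}
    {k : ∀ μ : Ordinal.{0}, RawBiworld Atom Agent μ → TV} (hk : IsModal S k)
    (hm : PrecisionMono k) {r : Ordinal.{0}}
    (hS : ∀ μ, r ≤ μ → ∀ w : RawBiworld Atom Agent (μ + 1), IsPrebiworld w →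
      ∀ a ∈ S μ w, a ≠ TV.u) : DecidedFrom (r + 1) k := by
  have hsucc : ∀ μ, r ≤ μ → ∀ w : RawBiworld Atom Agent (μ + 1), IsPrebiworld w →
      k (μ + 1) w ≠ TV.u := fun μ hμ w hw => by
    rw [hk.2.1]; exact TV.glbT_ne_u (hS μ hμ w hw)
  intro μ hμ w hw he
  have h1 := hm μ w hw (r + 1) hμ
  rw [he, TV.leP_iff, or_self] at h1
  exact hsucc r le_rfl _ (hw.restr hμ) h1

theorem knowsVal_isModal (A : Agent) (g : ∀ μ : Ordinal.{0}, RawBiworld Atom Agent μ → TV) :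
    IsModal (fun μ w => {x | ∃ w' ∈ w.pos A, x = g μ w'}) (knowsVal A g) := by
  refine ⟨fun w => ?_, fun μ w => ?_, fun l hl w hw => ?_⟩
  · unfold knowsVal; rw [Ordinal.limitRecOn_zero]
  · unfold knowsVal; rw [Ordinal.limitRecOn_add_one]
  · conv_lhs => unfold knowsVal
    rw [Ordinal.limitRecOn_limit _ _ _ _ hl]
    congr 1
    ext x
    exact exists_congr fun α => exists_congr fun hα => by rw [restr_eq_elem hl hw α hα]; rfl

theorem atMostVal_isModal (A : Agent) (g : ∀ μ : Ordinal.{0}, RawBiworld Atom Agent μ → TV) :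
    IsModal (fun μ w => {x | ∃ w' ∈ w.neg A, x = (g μ w').inv}) (atMostVal A g) := by
  refine ⟨fun w => ?_, fun μ w => ?_, fun l hl w hw => ?_⟩
  · unfold atMostVal; rw [Ordinal.limitRecOn_zero]
  · unfold atMostVal; rw [Ordinal.limitRecOn_add_one]
  · conv_lhs => unfold atMostVal
    rw [Ordinal.limitRecOn_limit _ _ _ _ hl]
    congr 1
    ext x
    exact exists_congr fun α => exists_congr fun hα => by rw [restr_eq_elem hl hw α hα]; rfl

section

variable {g : ∀ μ : Ordinal.{0}, RawBiworld Atom Agent μ → TV}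

theorem PrecisionMono.knowsVal (hg : PrecisionMono g) (A : Agent) :
    PrecisionMono (knowsVal A g) := by
  refine (knowsVal_isModal A g).precisionMono fun β w hw α h => ?_
  rw [isPrebiworld_succ] at hw
  rw [pos_restr_succ _ h]
  constructor
  · rintro _ ⟨_, ⟨x, hx, rfl⟩, rfl⟩
    exact ⟨_, ⟨x, hx, rfl⟩, hg _ x ((hw A).1 x hx) _ _⟩
  · rintro _ ⟨x, hx, rfl⟩
    exact ⟨_, ⟨_, ⟨x, hx, rfl⟩, rfl⟩, hg _ x ((hw A).1 x hx) _ _⟩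

theorem PrecisionMono.atMostVal (hg : PrecisionMono g) (A : Agent) :
    PrecisionMono (atMostVal A g) := by
  refine (atMostVal_isModal A g).precisionMono fun β w hw α h => ?_
  rw [isPrebiworld_succ] at hw
  rw [neg_restr_succ _ h]
  constructor
  · rintro _ ⟨_, ⟨x, hx, rfl⟩, rfl⟩
    exact ⟨_, ⟨x, hx, rfl⟩, TV.leP_inv (hg _ x ((hw A).2 x hx) _ _)⟩
  · rintro _ ⟨x, hx, rfl⟩
    exact ⟨_, ⟨_, ⟨x, hx, rfl⟩, rfl⟩, TV.leP_inv (hg _ x ((hw A).2 x hx) _ _)⟩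

theorem DecidedFrom.knowsVal {r : Ordinal.{0}} (hd : DecidedFrom r g) (hg : PrecisionMono g)
    (A : Agent) : DecidedFrom (r + 1) (knowsVal A g) := by
  refine (knowsVal_isModal A g).decidedFrom (hg.knowsVal A) fun μ hμ w hw => ?_
  rintro _ ⟨x, hx, rfl⟩
  exact hd μ hμ x (((isPrebiworld_succ w).1 hw A).1 x hx)

theorem DecidedFrom.atMostVal {r : Ordinal.{0}} (hd : DecidedFrom r g) (hg : PrecisionMono g)
    (A : Agent) : DecidedFrom (r + 1) (atMostVal A g) := by
  refine (atMostVal_isModal A g).decidedFrom (hg.atMostVal A) fun μ hμ w hw => ?_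
  rintro _ ⟨x, hx, rfl⟩
  exact TV.inv_ne_u (hd μ hμ x (((isPrebiworld_succ w).1 hw A).2 x hx))

theorem PrecisionMono.everyoneVal (hg : PrecisionMono g) (G : Set Agent) :
    PrecisionMono (everyoneVal G g) := by
  intro β w hw α h
  refine TV.leP_glbT ?_ ?_
  · rintro _ ⟨A, hA, rfl⟩
    exact ⟨_, ⟨A, hA, rfl⟩, hg.knowsVal A β w hw α h⟩
  · rintro _ ⟨A, hA, rfl⟩
    exact ⟨_, ⟨A, hA, rfl⟩, hg.knowsVal A β w hw α h⟩

theorem DecidedFrom.everyoneVal {r : Ordinal.{0}} (hd : DecidedFrom r g) (hg : PrecisionMono g)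
    (G : Set Agent) : DecidedFrom (r + 1) (everyoneVal G g) := by
  intro μ hμ w hw
  refine TV.glbT_ne_u ?_
  rintro _ ⟨A, _, rfl⟩
  exact hd.knowsVal hg A μ hμ w hw

theorem PrecisionMono.iterate_everyoneVal (hg : PrecisionMono g) (G : Set Agent) (k : ℕ) :
    PrecisionMono ((Formula.everyoneVal G)^[k] g) := by
  induction k with
  | zero => exact hg
  | succ k ih => rw [Function.iterate_succ_apply']; exact ih.everyoneVal G

theorem DecidedFrom.iterate_everyoneVal {r : Ordinal.{0}} (hd : DecidedFrom r g)
    (hg : PrecisionMono g) (G : Set Agent) (k : ℕ) :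
    DecidedFrom (r + k) ((Formula.everyoneVal G)^[k] g) := by
  induction k with
  | zero => simpa using hd
  | succ k ih =>
    rw [Function.iterate_succ_apply', Nat.cast_succ, ← add_assoc]
    exact ih.everyoneVal (hg.iterate_everyoneVal G k) G

end

theorem val_precisionMono (φ : Formula Atom Agent) : PrecisionMono φ.val := by
  induction φ with
  | atom p =>
    intro β w hw α h
    simp only [val]
    rw [obj_restr h hw]
    exact TV.leP_iff.2 (Or.inr rfl)
  | neg φ ih => exact fun β w hw α h => TV.leP_inv (ih β w hw α h)
  | and φ ψ ih₁ ih₂ =>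
    intro β w hw α h
    refine TV.leP_glbT ?_ ?_
    · rintro _ (rfl | rfl)
      · exact ⟨_, Or.inl rfl, ih₁ β w hw α h⟩
      · exact ⟨_, Or.inr rfl, ih₂ β w hw α h⟩
    · rintro _ (rfl | rfl)
      · exact ⟨_, Or.inl rfl, ih₁ β w hw α h⟩
      · exact ⟨_, Or.inr rfl, ih₂ β w hw α h⟩
  | knows A φ ih => exact ih.knowsVal A
  | atMost A φ ih => exact ih.atMostVal A
  | everyone G φ ih => exact ih.everyoneVal G
  | common G φ ih =>
    intro β w hw α h
    refine TV.leP_glbT ?_ ?_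
    · rintro _ ⟨k, hk, rfl⟩
      exact ⟨_, ⟨k, hk, rfl⟩, ih.iterate_everyoneVal G k β w hw α h⟩
    · rintro _ ⟨k, hk, rfl⟩
      exact ⟨_, ⟨k, hk, rfl⟩, ih.iterate_everyoneVal G k β w hw α h⟩

theorem omega0_mul_nat_add_le (n k : ℕ) :
    Ordinal.omega0 * (n : Ordinal.{0}) + k ≤ Ordinal.omega0 * (n + 1 : ℕ) := by
  rw [Nat.cast_succ, mul_add, mul_one]
  gcongr
  exact (Ordinal.natCast_lt_omega0 k).le

/-- Every formula is decided from some depth `ω * n` on. -/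
theorem exists_decidedFrom (φ : Formula Atom Agent) :
    ∃ n : ℕ, DecidedFrom (Ordinal.omega0 * n) φ.val := by
  -- K, M and E cost only one level; rounding up to the next multiple of ω keeps the bound in the
  -- form ω·n.
  have hone : ∀ n : ℕ, Ordinal.omega0 * (n : Ordinal.{0}) + 1 ≤ Ordinal.omega0 * (n + 1 : ℕ) :=
    fun n => by
    have := omega0_mul_nat_add_le n 1; rwa [Nat.cast_one] at this
  induction φ with
  | atom p =>
    refine ⟨0, fun μ _ w _ => ?_⟩
    simp only [val]
    split_ifs <;> simp
  | neg φ ih =>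
    obtain ⟨n, hn⟩ := ih
    exact ⟨n, fun μ hμ w hw => TV.inv_ne_u (hn μ hμ w hw)⟩
  | and φ ψ ih₁ ih₂ =>
    obtain ⟨m, hm⟩ := ih₁
    obtain ⟨n, hn⟩ := ih₂
    have h₁ : Ordinal.omega0 * (m : Ordinal.{0}) ≤ Ordinal.omega0 * (max m n : ℕ) := by
      gcongr; exact le_max_left m n
    have h₂ : Ordinal.omega0 * (n : Ordinal.{0}) ≤ Ordinal.omega0 * (max m n : ℕ) := by
      gcongr; exact le_max_right m n
    refine ⟨max m n, fun μ hμ w hw => TV.glbT_ne_u ?_⟩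
    rintro _ (rfl | rfl)
    · exact hm.mono h₁ μ hμ w hw
    · exact hn.mono h₂ μ hμ w hw
  | knows A φ ih =>
    obtain ⟨n, hn⟩ := ih
    exact ⟨n + 1, (hn.knowsVal (val_precisionMono φ) A).mono (hone n)⟩
  | atMost A φ ih =>
    obtain ⟨n, hn⟩ := ih
    exact ⟨n + 1, (hn.atMostVal (val_precisionMono φ) A).mono (hone n)⟩
  | everyone G φ ih =>
    obtain ⟨n, hn⟩ := ih
    exact ⟨n + 1, (hn.everyoneVal (val_precisionMono φ) G).mono (hone n)⟩
  | common G φ ih =>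
    obtain ⟨n, hn⟩ := ih
    -- The iterate E_G^k φ is decided from ω·n + k on, so all iterates together are decided from
    -- ω·(n+1). Nested common knowledge thus leads to ω².
    refine ⟨n + 1, fun μ hμ w hw => TV.glbT_ne_u ?_⟩
    rintro _ ⟨k, _, rfl⟩
    exact (hn.iterate_everyoneVal (val_precisionMono φ) G k).mono (omega0_mul_nat_add_le n k) μ hμ w hw

theorem omega0_mul_nat_le_omegaSq (n : ℕ) : Ordinal.omega0 * (n : Ordinal.{0}) ≤ omegaSq := by
  rw [omegaSq_eq]
  gcongr
  exact (Ordinal.natCast_lt_omega0 n).le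

theorem val_decidedFrom_omegaSq (φ : Formula Atom Agent) : DecidedFrom omegaSq φ.val := by
  obtain ⟨n, hn⟩ := exists_decidedFrom φ
  exact hn.mono (omega0_mul_nat_le_omegaSq n)

end Formula

-- Worlds and agreement with the canonical Kripke structure.

namespace CompletedWorld

open RawBiworld Formula

variable {Atom : Type u} {Agent : Type v}

theorem coherent_omegaSq_add_one : Coherent Atom Agent (omegaSq + 1) :=
  coherent_of_countable _ countable_Iio_omegaSq_add_one

theorem isPrebiworld (w : CompletedWorld Atom Agent) : IsPrebiworld w.1 :=
  isPrebiworld_of_mem w.2.1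

/-- The underlying biworld of depth `ω²` of a world. -/
noncomputable def base (w : CompletedWorld Atom Agent) : RawBiworld Atom Agent omegaSq :=
  restr omegaSq (le_succ _) w.1

theorem base_mem (w : CompletedWorld Atom Agent) : w.base ∈ biworlds omegaSq :=
  coherent_omegaSq_add_one.restr_mem _ _ _ w.2.1

theorem disjoint (w : CompletedWorld Atom Agent) (A : Agent) :
    Disjoint (w.1.pos A) (w.1.neg A) :=
  Set.disjoint_left.2 fun _ hp hn =>
    w.2.2 (incompleted_of_mem coherent_omegaSq_add_one w.2.1 hp hn)

/-- Every biworld of depth `ω²` extends to a world. -/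
theorem exists_base_eq {v : RawBiworld Atom Agent omegaSq} (hv : v ∈ biworlds omegaSq) :
    ∃ w : CompletedWorld Atom Agent, w.base = v := by
  obtain ⟨w, hw, hr, hd⟩ := exists_decided_extension
    (countable_Iio_omegaSq_add_one.mono (Set.Iio_subset_Iio (le_succ _)))
    (coherent_of_countable _
      (countable_Iio_omegaSq_add_one.mono (Set.Iio_subset_Iio (le_succ _)))) hv
  exact ⟨⟨w, hw, not_incompleted_of_disjoint hd⟩, hr⟩

section

variable {g : ∀ μ : Ordinal.{0}, RawBiworld Atom Agent μ → TV}

/-- Links the depth ω² of the elements of A^w with the depth ω²+1 of worlds: a decided value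
persists under extension. -/
theorem val_base (hg : PrecisionMono g) (hd : DecidedFrom omegaSq g)
    (w : CompletedWorld Atom Agent) : g omegaSq w.base = g (omegaSq + 1) w.1 :=
  (TV.leP_iff.1 (hg _ w.1 w.isPrebiworld omegaSq (le_succ _))).resolve_left
    (hd omegaSq le_rfl _ (isPrebiworld_of_mem w.base_mem))

/-- Quantifying over possible ω²-biworlds or over the worlds above them is the same, because each
ω²-biworld underlies a world (`exists_base_eq`). -/
theorem knowsVal_eq_t_iff (hg : PrecisionMono g) (hd : DecidedFrom omegaSq g) (A : Agent)
    (w : CompletedWorld Atom Agent) : knowsVal A g (omegaSq + 1) w.1 = TV.t ↔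
      ∀ w' : CompletedWorld Atom Agent, w'.base ∈ w.1.pos A → g (omegaSq + 1) w'.1 = TV.t := by
  rw [(knowsVal_isModal A g).2.1, TV.glbT_eq_t_iff]
  constructor
  · intro h w' hw'
    rw [← val_base hg hd]
    exact h _ ⟨_, hw', rfl⟩
  · rintro h _ ⟨v, hv, rfl⟩
    obtain ⟨w', rfl⟩ := exists_base_eq (pos_subset w.2.1 A hv)
    rw [val_base hg hd]
    exact h w' hv

/-- M_A speaks of impossible biworlds in one semantics and of inaccessible worlds in the other. The
covering condition gives one direction; disjointness, hence completedness of `w`, the other. -/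
theorem atMostVal_eq_t_iff (hg : PrecisionMono g) (hd : DecidedFrom omegaSq g) (A : Agent)
    (w : CompletedWorld Atom Agent) : atMostVal A g (omegaSq + 1) w.1 = TV.t ↔
      ∀ w' : CompletedWorld Atom Agent, g (omegaSq + 1) w'.1 = TV.t → w'.base ∈ w.1.pos A := by
  rw [(atMostVal_isModal A g).2.1, TV.glbT_eq_t_iff]
  constructor
  · intro h w' hw'
    refine (mem_pos_or_neg w.2.1 A w'.base_mem).resolve_right fun hn => ?_
    have := TV.inv_eq_t_iff.1 (h _ ⟨_, hn, rfl⟩)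
    rw [val_base hg hd, hw'] at this
    exact nomatch this
  · rintro h _ ⟨v, hv, rfl⟩
    obtain ⟨w', rfl⟩ := exists_base_eq (neg_subset w.2.1 A hv)
    rw [TV.inv_eq_t_iff]
    have h1 : g omegaSq w'.base ≠ TV.t := fun ht =>
      Set.disjoint_left.1 (w.disjoint A) (h w' (by rw [← val_base hg hd, ht])) hv
    have h2 := hd omegaSq le_rfl _ (isPrebiworld_of_mem w'.base_mem)
    cases hx : g omegaSq w'.base
    · exact absurd hx h1
    · rfl
    · exact absurd hx h2

theorem everyoneVal_eq_t_iff (hg : PrecisionMono g) (hd : DecidedFrom omegaSq g) (G : Set Agent)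
    (w : CompletedWorld Atom Agent) : everyoneVal G g (omegaSq + 1) w.1 = TV.t ↔
      ∀ A ∈ G, ∀ w' : CompletedWorld Atom Agent, w'.base ∈ w.1.pos A →
        g (omegaSq + 1) w'.1 = TV.t := by
  rw [everyoneVal, TV.glbT_eq_t_iff]
  constructor
  · exact fun h A hA => (knowsVal_eq_t_iff hg hd A w).1 (h _ ⟨A, hA, rfl⟩)
  · rintro h _ ⟨A, hA, rfl⟩
    exact (knowsVal_eq_t_iff hg hd A w).2 (h A hA)

end

/-- At worlds, the three-valued valuation agrees with satisfaction in the canonical Kripke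
structure. -/
theorem sat_iff_val_eq_t (φ : Formula Atom Agent) (w : CompletedWorld Atom Agent) :
    (canonicalKripke Atom Agent).Sat φ w ↔ φ.val (omegaSq + 1) w.1 = TV.t := by
  induction φ generalizing w with
  | atom p =>
    simp only [KripkeStructure.Sat, val, canonicalKripke]
    split_ifs with h <;> simp [h]
  | neg φ ih =>
    simp only [KripkeStructure.Sat, val, ih, TV.inv_eq_t_iff]
    have := val_decidedFrom_omegaSq φ (omegaSq + 1) (le_succ _) w.1 w.isPrebiworld
    cases h : φ.val (omegaSq + 1) w.1 <;> simp_all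
  | and φ ψ ih₁ ih₂ => simp [KripkeStructure.Sat, val, ih₁, ih₂, TV.glbT_eq_t_iff]
  | knows A φ ih =>
    have ih : ∀ w : (canonicalKripke Atom Agent).World, (canonicalKripke Atom Agent).Sat φ w ↔
        φ.val (omegaSq + 1) (Subtype.val w) = TV.t := ih
    simp only [KripkeStructure.Sat, ih]
    exact (knowsVal_eq_t_iff (val_precisionMono φ) (val_decidedFrom_omegaSq φ) A w).symm
  | atMost A φ ih =>
    have ih : ∀ w : (canonicalKripke Atom Agent).World, (canonicalKripke Atom Agent).Sat φ w ↔
        φ.val (omegaSq + 1) (Subtype.val w) = TV.t := ih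
    simp only [KripkeStructure.Sat, ih]
    exact (atMostVal_eq_t_iff (val_precisionMono φ) (val_decidedFrom_omegaSq φ) A w).symm
  | everyone G φ ih =>
    have ih : ∀ w : (canonicalKripke Atom Agent).World, (canonicalKripke Atom Agent).Sat φ w ↔
        φ.val (omegaSq + 1) (Subtype.val w) = TV.t := ih
    simp only [KripkeStructure.Sat, ih]
    exact (everyoneVal_eq_t_iff (val_precisionMono φ) (val_decidedFrom_omegaSq φ) G w).symm
  | common G φ ih =>
    have ih : ∀ w : (canonicalKripke Atom Agent).World, (canonicalKripke Atom Agent).Sat φ w ↔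
        φ.val (omegaSq + 1) (Subtype.val w) = TV.t := ih
    have hstep : ∀ (k : ℕ) (w : CompletedWorld Atom Agent),
        (everyoneVal G)^[k + 1] φ.val (omegaSq + 1) w.1 = TV.t ↔
          ∀ A ∈ G, ∀ w' : CompletedWorld Atom Agent, w'.base ∈ w.1.pos A →
            (everyoneVal G)^[k] φ.val (omegaSq + 1) w'.1 = TV.t := by
      intro k w
      obtain ⟨n, hn⟩ := exists_decidedFrom φ
      rw [Function.iterate_succ_apply']
      refine everyoneVal_eq_t_iff ((val_precisionMono φ).iterate_everyoneVal G k)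
        ((hn.iterate_everyoneVal (val_precisionMono φ) G k).mono ?_) G w
      refine le_trans ?_ (omega0_mul_nat_le_omegaSq (n + 1))
      exact omega0_mul_nat_add_le n k
    simp only [KripkeStructure.Sat, ih, val, TV.glbT_eq_t_iff]
    constructor
    · rintro h _ ⟨k, hk, rfl⟩
      obtain ⟨k, rfl⟩ := Nat.exists_eq_succ_of_ne_zero (by omega : k ≠ 0)
      clear hk
      induction k generalizing w with
      | zero => exact (hstep 0 w).2 fun A hA w' hw' => h w' (.single ⟨A, hA, hw'⟩)
      | succ k ihk =>
        exact (hstep (k + 1) w).2 fun A hA w' hw' =>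
          ihk w' fun w'' hw'' => h w'' (.head ⟨A, hA, hw'⟩ hw'')
    · intro h w' hw'
      -- Truth of φ alone does not propagate along a path; truth of all iterates does, as each step
      -- uses up one E_G.
      suffices H : ∀ k, (everyoneVal G)^[k] φ.val (omegaSq + 1) w'.1 = TV.t from H 0
      induction hw' with
      | single hR =>
        obtain ⟨A, hA, hR⟩ := hR
        exact fun k => (hstep k w).1 (h _ ⟨k + 1, by omega, rfl⟩) A hA _ hR
      | tail _ hR ih' =>
        obtain ⟨A, hA, hR⟩ := hR
        exact fun k => (hstep k _).1 (ih' (k + 1)) A hA _ hR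

theorem onlyKnows_val_eq_t_iff (A : Agent) (φ : Formula Atom Agent)
    (w : CompletedWorld Atom Agent) : (onlyKnows A φ).val (omegaSq + 1) w.1 = TV.t ↔
      (∀ v ∈ w.1.pos A, φ.val omegaSq v = TV.t) ∧ ∀ v ∈ w.1.neg A, φ.val omegaSq v = TV.f := by
  simp only [onlyKnows, val, TV.glbT_eq_t_iff, Set.mem_insert_iff, Set.mem_singleton_iff,
    forall_eq_or_imp, forall_eq, (knowsVal_isModal A _).2.1, (atMostVal_isModal A _).2.1]
  refine ⟨fun h => ⟨fun v hv => h.1 _ ⟨v, hv, rfl⟩,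
    fun v hv => TV.inv_eq_t_iff.1 (h.2 _ ⟨v, hv, rfl⟩)⟩, fun h => ⟨?_, ?_⟩⟩
  · rintro _ ⟨v, hv, rfl⟩; exact h.1 v hv
  · rintro _ ⟨v, hv, rfl⟩; exact TV.inv_eq_t_iff.2 (h.2 v hv)

/-- If `A` only knows `φ`, then the biworlds possible for `A` are those satisfying `φ`. -/
theorem eq_of_onlyKnows {A : Agent} {φ : Formula Atom Agent} {w : CompletedWorld Atom Agent}
    (h : (onlyKnows A φ).val (omegaSq + 1) w.1 = TV.t) :
    w.1.pos A = {v | v ∈ biworlds omegaSq ∧ φ.val omegaSq v = TV.t} ∧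
      w.1.neg A = {v | v ∈ biworlds omegaSq ∧ φ.val omegaSq v = TV.f} := by
  rw [onlyKnows_val_eq_t_iff] at h
  constructor
  · ext v
    refine ⟨fun hv => ⟨pos_subset w.2.1 A hv, h.1 v hv⟩, fun hv => ?_⟩
    refine (mem_pos_or_neg w.2.1 A hv.1).resolve_right fun hn => ?_
    exact nomatch hv.2.symm.trans (h.2 v hn)
  · ext v
    refine ⟨fun hv => ⟨neg_subset w.2.1 A hv, h.2 v hv⟩, fun hv => ?_⟩
    refine (mem_pos_or_neg w.2.1 A hv.1).resolve_left fun hp => ?_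
    exact nomatch hv.2.symm.trans (h.1 v hp)

/-- There is no circularity: φ is evaluated at depth ω², below the world being built. The
interpretation ∅ is arbitrary, and every agent gets the same split merely so that the covering and
disjointness conditions hold for all of them. -/
theorem exists_onlyKnows (A : Agent) (φ : Formula Atom Agent) :
    ∃ w : CompletedWorld Atom Agent, (onlyKnows A φ).val (omegaSq + 1) w.1 = TV.t := by
  let p : Agent → Set (RawBiworld Atom Agent omegaSq) := fun _ =>
    {v | v ∈ biworlds omegaSq ∧ φ.val omegaSq v = TV.t}
  let n : Agent → Set (RawBiworld Atom Agent omegaSq) := fun _ =>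
    {v | v ∈ biworlds omegaSq ∧ φ.val omegaSq v = TV.f}
  have hd : ∀ B, Disjoint (p B) (n B) := fun B =>
    Set.disjoint_left.2 fun v hv hv' => nomatch hv.2.symm.trans hv'.2
  have hmem : mk ∅ p n ∈ biworlds (omegaSq + 1) := by
    refine mk_mem_biworlds (fun _ _ hv => hv.1) (fun _ _ hv => hv.1) (fun B v hv => ?_)
      fun B v hv hv' => (Set.disjoint_left.1 (hd B) hv hv').elim
    have := val_decidedFrom_omegaSq φ omegaSq le_rfl v (isPrebiworld_of_mem hv)
    cases h : φ.val omegaSq v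
    · exact Or.inl ⟨hv, h⟩
    · exact Or.inr ⟨hv, h⟩
    · exact absurd h this
  refine ⟨⟨mk ∅ p n, hmem, not_incompleted_of_disjoint fun B => ?_⟩, ?_⟩
  · rw [pos_mk, neg_mk]; exact hd B
  · refine (onlyKnows_val_eq_t_iff A φ _).2 ?_
    simp only [pos_mk, neg_mk]
    exact ⟨fun v hv => hv.2, fun v hv => hv.2⟩

end CompletedWorld

theorem theorem4 {Atom : Type u} {Agent : Type v} (A : Agent) (φ : Formula Atom Agent) :
    (∃ w : CompletedWorld Atom Agent,
      (Formula.onlyKnows A φ).val (omegaSq + 1) w.1 = TV.t ∧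
      (canonicalKripke Atom Agent).val (Formula.onlyKnows A φ) w = TV.t) ∧
    ∀ w₁ w₂ : CompletedWorld Atom Agent,
      ((Formula.onlyKnows A φ).val (omegaSq + 1) w₁.1 = TV.t ∧
        (canonicalKripke Atom Agent).val (Formula.onlyKnows A φ) w₁ = TV.t) →
      ((Formula.onlyKnows A φ).val (omegaSq + 1) w₂.1 = TV.t ∧
        (canonicalKripke Atom Agent).val (Formula.onlyKnows A φ) w₂ = TV.t) →
      w₁.1.pos A = w₂.1.pos A ∧ w₁.1.neg A = w₂.1.neg A := by
  constructor
  · obtain ⟨w, hw⟩ := CompletedWorld.exists_onlyKnows A φ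
    exact ⟨w, hw, if_pos ((CompletedWorld.sat_iff_val_eq_t _ w).2 hw)⟩
  · intro w₁ w₂ h₁ h₂
    obtain ⟨hp₁, hn₁⟩ := CompletedWorld.eq_of_onlyKnows h₁.1
    obtain ⟨hp₂, hn₂⟩ := CompletedWorld.eq_of_onlyKnows h₂.1
    exact ⟨hp₁.trans hp₂.symm, hn₁.trans hn₂.symm⟩
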